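/- Let $m \ge 0$, $k$, $n$ be integers. On $\mathbb{Z}^N$ (and on sets identified with it by listing integer coordinates) let $B_r=\{v : \|v\|_\infty\le r\}$, $r=0,1,2,\dots$, and for a subset $M$ put $\rho_r(M)=|M\cap B_r|/|B_r|$. Let $\rho(M)=\lim_{r\to\infty}\rho_r(M)$ be the asymptotic density of $M$ (when the limit exists), and let $\overline{\rho}(M)=\limsup_{r\to\infty}\rho_r(M)$ and $\underline{\rho}(M)=\liminf_{r\to\infty}\rho_r(M)$ be its upper and lower asymptotic densities. An equation in $k$ variables over the group $\mathbb{Z}^m$ is an expression $\gamma_1\mathbf{x}_1+\dots+\gamma_k\mathbf{x}_k=\mathbf{b}$ with $\gamma_j\in\mathbb{Z}$, $\mathbf{b}\in\mathbb{Z}^m$ and variables $\mathbf{x}_j$ ranging over $\mathbb{Z}^m$; it is identified with the point $(\gamma_1,\dots,\gamma_k,\mathbf{b})\in\mathbb{Z}^{k+m}$, and a system of $n$ such equations with a point of $\mathbb{Z}^{n(k+m)}$. Let $SAT(\mathbb{Z}^m,k)\subset\mathbb{Z}^{k+m}$ be the set of equations that have a solution in $\mathbb{Z}^m$, and $SAT(\mathbb{Z}^m,k,n)\subset\mathbb{Z}^{n(k+m)}$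 the set of systems of $n$ equations that have a common solution in $\mathbb{Z}^m$. For $n\le k$ let $U_{n,k}\subset\mathbb{Z}^{nk}$ be the set of unimodular integer $n\times k$ matrices, i.e. those whose $n\times n$ minors have greatest common divisor $1$. Let $\zeta$ be the Riemann zeta function. (1) If $k>n>1$, then the density $\rho(U_{n,k})$ exists and $$\Bigl(\prod_{j=k-n+1}^{k}\zeta(j)\Bigr)^{-1}=\rho(U_{n,k})\le\underline{\rho}(SAT(\mathbb{Z}^m,k,n)).$$ (2) If $k\ge n>1$, then the density $\rho(SAT(\mathbb{Z}^m,k))$ exists and $$\overline{\rho}(SAT(\mathbb{Z}^m,k,n))\le\rho(SAT(\mathbb{Z}^m,k))^{n}=\Bigl(\frac{\zeta(k+m)}{\zeta(k)}\Bigr)^{n}.$$ -/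

import Mathlib

open Filter Topology

/-- A stratification of a set `T`: a sequence of non-empty finite subsets whose union is `T`. -/
structure Stratification (T : Type*) where
  stratum : ℕ → Set T
  finite : ∀ r, (stratum r).Finite
  nonempty : ∀ r, (stratum r).Nonempty
  iUnion_eq : ⋃ r, stratum r = Set.univ

namespace Stratification

variable {T : Type*}

/-- The proportion `|M ∩ T_r| / |T_r|`. -/
noncomputable def proportion (S : Stratification T) (M : Set T) (r : ℕ) : ℝ :=
  ((M ∩ S.stratum r).ncard : ℝ) / ((S.stratum r).ncard : ℝ)

/-- The asymptotic density of `M` exists and equals `d`. -/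
def HasDensity (S : Stratification T) (M : Set T) (d : ℝ) : Prop :=
  Tendsto (S.proportion M) atTop (𝓝 d)

/-- The upper asymptotic density (the proportions lie in `[0, 1]`, so the limsup is genuine). -/
noncomputable def upperDensity (S : Stratification T) (M : Set T) : ℝ :=
  limsup (S.proportion M) atTop

/-- The lower asymptotic density (the proportions lie in `[0, 1]`, so the liminf is genuine). -/
noncomputable def lowerDensity (S : Stratification T) (M : Set T) : ℝ :=
  liminf (S.proportion M) atTop

/-- The stratification by the balls `{x | ‖x‖ ≤ r}`, for a discrete normed group with finite balls.
On iterated finite products of copies of `ℤ`, Mathlib's norm is the uniform norm, that is, the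
maximum of the absolute values of all integer coordinates. -/
def balls (E : Type*) [NormedAddCommGroup E] [ProperSpace E] [DiscreteTopology E] :
    Stratification E where
  stratum r := {x | ‖x‖ ≤ (r : ℝ)}
  finite r := by
    have h : {x : E | ‖x‖ ≤ (r : ℝ)} = Metric.closedBall 0 (r : ℝ) := by
      ext x
      simp
    rw [h]
    exact (isCompact_closedBall (0 : E) (r : ℝ)).finite_of_discrete
  nonempty r := ⟨0, by simp⟩
  iUnion_eq := by
    ext x
    simpa using exists_nat_ge ‖x‖

end Stratification

/-- The space of equations `γ₁ x₁ + ⋯ + γₖ xₖ = b` in `k` variables over an abelian group `G`: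
the coefficients `γⱼ` are integers, the right-hand side `b` is in `G`. -/
abbrev GroupEquation (G : Type*) (k : ℕ) : Type _ := (Fin k → ℤ) × G

/-- The space of systems of `n` equations in `k` variables over `G`. -/
abbrev EquationSystem (G : Type*) (k n : ℕ) : Type _ := Fin n → GroupEquation G k

/-- The assignment `x` of elements of `G` to the variables solves the equation `e`. -/
def GroupEquation.IsSolution {G : Type*} [AddCommGroup G] {k : ℕ} (e : GroupEquation G k)
    (x : Fin k → G) : Prop :=
  ∑ j, e.1 j • x j = e.2

/-- `SAT(G, k)`: the equations in `k` variables over `G` that have a solution in `G`. -/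
def satEquations (G : Type*) [AddCommGroup G] (k : ℕ) : Set (GroupEquation G k) :=
  {e | ∃ x : Fin k → G, e.IsSolution x}

/-- `SAT(G, k, n)`: the systems of `n` equations in `k` variables over `G` that have a
(common) solution in `G`. -/
def satSystems (G : Type*) [AddCommGroup G] (k n : ℕ) : Set (EquationSystem G k n) :=
  {s | ∃ x : Fin k → G, ∀ i, (s i).IsSolution x}

/-- The greatest divisor of an integer `n × k` matrix (`n ≤ k`): the (non-negative) greatest
common divisor of the determinants of its `n × n` submatrices, obtained by choosing `n` columns. -/
noncomputable def greatestDivisor {n k : ℕ} (A : Matrix (Fin n) (Fin k) ℤ) : ℤ :=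
  Finset.univ.gcd fun c : Fin n ↪o Fin k => (A.submatrix id c).det

/-- The set of unimodular integer `n × k` matrices (`n ≤ k`), each given by its array of entries. -/
def unimodularMatrices (n k : ℕ) : Set (Fin n → Fin k → ℤ) :=
  {A | greatestDivisor (Matrix.of A) = 1}

/-! Lower bound. An integer matrix `A` is unimodular exactly when its rows are independent modulo
every prime. It then has an integral right inverse, so every system with coefficient matrix `A` is
solvable, whatever its right-hand sides (`mem_satSystems_of_greatestDivisor_eq_one`). It remains to
find the density of the unimodular matrices by a sieve over primes in the ball of radius `r`
(`hasDensity_unimodular_of_tendsto`). Primes up to a fixed `P`: the Chinese remainder theorem gives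
the exact density, a product of local factors. Primes in `(P, 2r+1]`: rows are dependent for a
proportion `O(1/p²)` of matrices because `n < k`, and the sum over `p` is `O(1/P)`. Primes above
`2r+1`: there are infinitely many, so they are treated together. At the first dependent row some
minor `μ` of the preceding rows is nonzero modulo `p`, and two columns lie outside it. Both minors
bordered by the new row and one of these columns are divisible by `p`. The first, unless it
vanishes, has boundedly many prime factors of this size; for each of them the second determines one
entry of the row. The loss is `O(1/r)` (`exists_proportion_large_prime_le`). Euler products then
give the zeta values. Upper bound. Every equation of a solvable system is solvable, and balls are
products, so an `n`-th power appears. One equation is solvable iff the gcd `d` of its coefficients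
divides the right-hand side, so it is `d` times an equation with primitive coefficients in the ball
of radius `⌊r/d⌋`. Primitive vectors have density `1/ζ(k)` (unimodular matrices with one row), and
summing `d^{-(k+m)}/ζ(k)` over `d` gives the ratio (`hasDensity_satEquations`). -/

namespace Stratification

/-! ### Finite additivity and monotonicity of proportions -/

section General

variable {T : Type*} (S : Stratification T)

lemma ncard_stratum_pos (r : ℕ) : 0 < ((S.stratum r).ncard : ℝ) := by
  exact_mod_cast (Set.ncard_pos (S.finite r)).2 (S.nonempty r)

lemma proportion_nonneg (M : Set T) (r : ℕ) : 0 ≤ S.proportion M r := by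
  unfold proportion; positivity

lemma proportion_mono_on {M N : Set T} {r : ℕ} (h : ∀ x ∈ S.stratum r, x ∈ M → x ∈ N) :
    S.proportion M r ≤ S.proportion N r := by
  unfold proportion
  have : (M ∩ S.stratum r).ncard ≤ (N ∩ S.stratum r).ncard :=
    Set.ncard_le_ncard (fun x hx => ⟨h x hx.2 hx.1, hx.2⟩) ((S.finite r).inter_of_right N)
  gcongr

lemma proportion_mono {M N : Set T} (h : M ⊆ N) (r : ℕ) :
    S.proportion M r ≤ S.proportion N r :=
  S.proportion_mono_on fun _ _ hx => h hx

lemma proportion_univ (r : ℕ) : S.proportion Set.univ r = 1 := by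
  unfold proportion
  rw [Set.univ_inter, div_self (S.ncard_stratum_pos r).ne']

lemma proportion_empty (r : ℕ) : S.proportion ∅ r = 0 := by
  simp [proportion]

lemma proportion_le_one (M : Set T) (r : ℕ) : S.proportion M r ≤ 1 :=
  (S.proportion_mono (Set.subset_univ M) r).trans_eq (S.proportion_univ r)

lemma proportion_union_le (M N : Set T) (r : ℕ) :
    S.proportion (M ∪ N) r ≤ S.proportion M r + S.proportion N r := by
  unfold proportion
  rw [← add_div, Set.union_inter_distrib_right]
  gcongr
  exact_mod_cast Set.ncard_union_le _ _

lemma proportion_biUnion_le {ι : Type*} (s : Finset ι) (M : ι → Set T) (r : ℕ) :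
    S.proportion (⋃ i ∈ s, M i) r ≤ ∑ i ∈ s, S.proportion (M i) r := by
  classical
  induction s using Finset.induction_on with
  | empty => simp [proportion_empty]
  | insert a s ha ih =>
    rw [Finset.set_biUnion_insert, Finset.sum_insert ha]
    exact (S.proportion_union_le _ _ r).trans (by gcongr)

lemma proportion_union {M N : Set T} (h : Disjoint M N) (r : ℕ) :
    S.proportion (M ∪ N) r = S.proportion M r + S.proportion N r := by
  unfold proportion
  rw [← add_div, Set.union_inter_distrib_right, Set.ncard_union_eq
    (h.mono Set.inter_subset_left Set.inter_subset_left)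
    ((S.finite r).inter_of_right M) ((S.finite r).inter_of_right N)]
  push_cast
  rfl

lemma proportion_biUnion {ι : Type*} (s : Finset ι) (M : ι → Set T)
    (h : (s : Set ι).PairwiseDisjoint M) (r : ℕ) :
    S.proportion (⋃ i ∈ s, M i) r = ∑ i ∈ s, S.proportion (M i) r := by
  classical
  induction s using Finset.induction_on with
  | empty => simp [proportion_empty]
  | insert a s ha ih =>
    rw [Finset.set_biUnion_insert, Finset.sum_insert ha, proportion_union, ih]
    · exact h.subset (by simp)
    · rw [Set.disjoint_iUnion₂_right]
      intro i hi
      exact h (by simp) (by simp [hi]) (by rintro rfl; exact ha hi)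

lemma proportion_preimage {α : Type*} (f : T → α) (s : Finset α) (r : ℕ) :
    S.proportion (f ⁻¹' s) r = ∑ a ∈ s, S.proportion (f ⁻¹' {a}) r := by
  rw [← S.proportion_biUnion]
  · congr 1; ext; simp
  · intro a _ b _ hab
    exact Disjoint.preimage f (by simpa using hab)

lemma isBoundedUnder_proportion_le (M : Set T) :
    IsBoundedUnder (· ≤ ·) atTop (S.proportion M) :=
  isBoundedUnder_of ⟨1, fun r => S.proportion_le_one M r⟩

lemma isBoundedUnder_proportion_ge (M : Set T) :
    IsBoundedUnder (· ≥ ·) atTop (S.proportion M) :=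
  isBoundedUnder_of ⟨0, fun r => S.proportion_nonneg M r⟩

end General

/-! ### Proportions in products of balls -/

section Balls

variable {E F : Type*} [NormedAddCommGroup E] [ProperSpace E] [DiscreteTopology E]
  [NormedAddCommGroup F] [ProperSpace F] [DiscreteTopology F]

lemma mem_balls {r : ℕ} {x : E} : x ∈ (balls E).stratum r ↔ ‖x‖ ≤ r := Iff.rfl

lemma mem_balls_pi {ι : Type*} [Fintype ι] {r : ℕ} {x : ι → E} :
    x ∈ (balls (ι → E)).stratum r ↔ ∀ i, x i ∈ (balls E).stratum r :=
  pi_norm_le_iff_of_nonneg (Nat.cast_nonneg r)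

lemma balls_pi_inter {ι : Type*} [Fintype ι] (M : ι → Set E) (r : ℕ) :
    {x : ι → E | ∀ i, x i ∈ M i} ∩ (balls (ι → E)).stratum r =
      Set.pi Set.univ fun i => M i ∩ (balls E).stratum r := by
  ext x
  simp [mem_balls_pi, forall_and]

lemma ncard_pi {ι α : Type*} [Fintype ι] (M : ι → Set α) :
    (Set.pi Set.univ M).ncard = ∏ i, (M i).ncard := by
  simp only [← Nat.card_coe_set_eq]
  rw [Nat.card_congr (Equiv.Set.univPi M), Nat.card_pi]

lemma proportion_pi {ι : Type*} [Fintype ι] (M : ι → Set E) (r : ℕ) :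
    (balls (ι → E)).proportion {x | ∀ i, x i ∈ M i} r = ∏ i, (balls E).proportion (M i) r := by
  have h : (balls (ι → E)).stratum r = Set.pi Set.univ fun _ => (balls E).stratum r := by
    ext x; simp [mem_balls_pi]
  unfold proportion
  rw [balls_pi_inter, ncard_pi, h, ncard_pi, Finset.prod_div_distrib]
  push_cast
  rfl

lemma balls_prod (r : ℕ) :
    (balls (E × F)).stratum r = (balls E).stratum r ×ˢ (balls F).stratum r := by
  ext x
  simp [mem_balls, Prod.norm_def]

lemma proportion_prod (M : Set E) (N : Set F) (r : ℕ) :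
    (balls (E × F)).proportion (M ×ˢ N) r =
      (balls E).proportion M r * (balls F).proportion N r := by
  unfold proportion
  rw [balls_prod, Set.prod_inter_prod, Set.ncard_prod, Set.ncard_prod]
  push_cast
  rw [mul_div_mul_comm]

/-- A set whose sections along the coordinate `d` have proportion at most `c` has itself
proportion at most `c`. -/
lemma proportion_le_of_update {ι : Type*} [Fintype ι] [DecidableEq ι] (d : ι) (M : Set (ι → E))
    (r : ℕ) (c : ℝ)
    (h : ∀ v ∈ (balls (ι → E)).stratum r,
      (balls E).proportion {t | Function.update v d t ∈ M} r ≤ c) :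
    (balls (ι → E)).proportion M r ≤ c := by
  classical
  set B := ((balls (ι → E)).finite r).toFinset with hB
  set I := ((balls E).finite r).toFinset with hI
  have hBc : ((balls (ι → E)).stratum r).ncard = B.card := by
    rw [Set.ncard_eq_toFinset_card _ ((balls (ι → E)).finite r)]
  have hIc : ((balls E).stratum r).ncard = I.card := by
    rw [Set.ncard_eq_toFinset_card _ ((balls E).finite r)]
  have hBpos : (0 : ℝ) < B.card := hBc ▸ (balls (ι → E)).ncard_stratum_pos r
  have hIpos : (0 : ℝ) < I.card := hIc ▸ (balls E).ncard_stratum_pos r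
  have hmB : ∀ v, v ∈ B ↔ ∀ i, v i ∈ I := by
    intro v; simp [hB, hI, mem_balls_pi]
  have hMc : (M ∩ (balls (ι → E)).stratum r).ncard = (B.filter (· ∈ M)).card := by
    rw [← Set.ncard_coe_finset]; congr 1; ext; simp [hB, and_comm]
  have hsec : ∀ v ∈ B, ((I.filter fun t => Function.update v d t ∈ M).card : ℝ) ≤ c * I.card := by
    intro v hv
    have := h v (by simpa [hB] using hv)
    unfold proportion at this
    rw [hIc, div_le_iff₀ hIpos] at this
    have e : ({t | Function.update v d t ∈ M} ∩ (balls E).stratum r).ncard =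
        (I.filter fun t => Function.update v d t ∈ M).card := by
      rw [← Set.ncard_coe_finset]; congr 1; ext; simp [hI, and_comm]
    rwa [e] at this
  -- Double counting: exchanging the `d`-th coordinate of a vector with the extra scalar is a
  -- bijection between the two kinds of pairs.
  have hcount : (B.filter (· ∈ M)).card * I.card =
      ∑ v ∈ B, (I.filter fun t => Function.update v d t ∈ M).card := by
    rw [← Finset.card_product, ← Finset.card_sigma]
    refine Finset.card_bij' (fun p _ => ⟨Function.update p.1 d p.2, p.1 d⟩)
      (fun q _ => (Function.update q.1 d q.2, q.1 d)) ?_ ?_ ?_ ?_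
    · rintro ⟨w, s⟩ hw
      simp only [Finset.mem_product, Finset.mem_filter, Finset.mem_sigma, hmB] at hw ⊢
      refine ⟨fun i => ?_, hw.1.1 d, by simpa using hw.1.2⟩
      by_cases hi : i = d
      · subst hi; simpa using hw.2
      · simpa [hi] using hw.1.1 i
    · rintro ⟨v, t⟩ hv
      simp only [Finset.mem_product, Finset.mem_filter, Finset.mem_sigma, hmB] at hv ⊢
      refine ⟨⟨fun i => ?_, hv.2.2⟩, hv.1 d⟩
      by_cases hi : i = d
      · subst hi; simpa using hv.2.1
      · simpa [hi] using hv.1 i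
    · rintro ⟨w, s⟩ _; simp
    · rintro ⟨v, t⟩ _; simp
  unfold proportion
  rw [hMc, hBc, div_le_iff₀ hBpos, ← mul_le_mul_iff_left₀ hIpos]
  calc ((B.filter (· ∈ M)).card : ℝ) * I.card
      = ∑ v ∈ B, ((I.filter fun t => Function.update v d t ∈ M).card : ℝ) := by
        exact_mod_cast hcount
    _ ≤ ∑ v ∈ B, c * I.card := Finset.sum_le_sum hsec
    _ = c * B.card * I.card := by simp; ring

lemma mem_balls_int {r : ℕ} {x : ℤ} : x ∈ (balls ℤ).stratum r ↔ |x| ≤ (r : ℤ) := by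
  rw [mem_balls, Int.norm_eq_abs]
  exact_mod_cast Iff.rfl

/-- The half-open form is the one for which Mathlib counts residue classes by floors. -/
lemma balls_int (r : ℕ) : (balls ℤ).stratum r = Finset.Ioc (-(r : ℤ) - 1) r := by
  ext x
  rw [mem_balls_int, abs_le]
  simp

lemma ncard_balls_int (r : ℕ) : ((balls ℤ).stratum r).ncard = 2 * r + 1 := by
  rw [balls_int, Set.ncard_coe_finset, Int.card_Ioc]
  omega

lemma ncard_balls_pi {ι : Type*} [Fintype ι] (r : ℕ) :
    ((balls (ι → E)).stratum r).ncard = ((balls E).stratum r).ncard ^ Fintype.card ι := by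
  have h : (balls (ι → E)).stratum r = Set.pi Set.univ fun _ => (balls E).stratum r := by
    ext x; simp [mem_balls_pi]
  rw [h, ncard_pi]
  simp

end Balls

end Stratification

/-! ### Minors, independence modulo primes, and solvability -/

section Minors

/-- Row rank equals column rank, so a maximal independent set of columns has exactly `n` elements;
listed in increasing order they give an invertible submatrix. -/
lemma Matrix.exists_minor_ne_zero_of_linearIndependent {K : Type*} [Field K] {n k : ℕ}
    {A : Matrix (Fin n) (Fin k) K} (h : LinearIndependent K A.row) :
    ∃ c : Fin n ↪o Fin k, (A.submatrix id c).det ≠ 0 := by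
  classical
  obtain ⟨κ, a, ha, hspan, hli⟩ := exists_linearIndependent' K A.col
  have hfin : Finite κ := Finite.of_injective a ha
  have := Fintype.ofFinite κ
  have hcard : Fintype.card κ = n := by
    have h1 := finrank_span_eq_card hli
    rw [hspan, ← Matrix.rank_eq_finrank_span_cols, h.rank_matrix, Fintype.card_fin] at h1
    exact h1.symm
  set s : Finset (Fin k) := Finset.univ.image a with hs
  have hsc : s.card = n := by
    rw [hs, Finset.card_image_of_injective _ ha, Finset.card_univ, hcard]
  refine ⟨s.orderEmbOfFin hsc, ?_⟩
  have hmem : ∀ i, ∃ j, a j = s.orderEmbOfFin hsc i := fun i => by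
    obtain ⟨j, -, hj⟩ := Finset.mem_image.1
      (show _ ∈ Finset.univ.image a from s.orderEmbOfFin_mem hsc i)
    exact ⟨j, hj⟩
  choose f hf using hmem
  have hfinj : Function.Injective f := fun i j hij => by
    apply (s.orderEmbOfFin hsc).injective
    rw [← hf, ← hf, hij]
  have hli' : LinearIndependent K (A.submatrix id (s.orderEmbOfFin hsc)).col := by
    have e : (A.submatrix id (s.orderEmbOfFin hsc)).col = (A.col ∘ a) ∘ f := by
      ext i j
      change A j (s.orderEmbOfFin hsc i) = A j (a (f i))
      rw [hf]
    exact e ▸ hli.comp f hfinj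
  exact ((Matrix.isUnit_iff_isUnit_det _).1
    (Matrix.linearIndependent_cols_iff_isUnit.1 hli')).ne_zero

/-- Selecting columns is linear, and independence of images lifts. The map `c` need not be
increasing, which allows bordered minors with the extra column put last. -/
lemma Matrix.linearIndependent_row_of_minor_ne_zero {K ι κ : Type*} [Field K] [Fintype ι]
    [DecidableEq ι] {A : Matrix ι κ K} (c : ι → κ)
    (h : (A.submatrix id c).det ≠ 0) : LinearIndependent K A.row := by
  have h1 : LinearIndependent K (A.submatrix id c).row :=
    Matrix.linearIndependent_rows_iff_isUnit.2 ((Matrix.isUnit_iff_isUnit_det _).2 h.isUnit)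
  exact LinearIndependent.of_comp (LinearMap.funLeft K K c) h1

/-- The rows of the integer matrix `A` are linearly independent modulo `p`. -/
def RowsIndep (p : ℕ) {n k : ℕ} (A : Fin n → Fin k → ℤ) : Prop :=
  LinearIndependent (ZMod p) fun i j => (A i j : ZMod p)

lemma intCast_minor {R : Type*} [CommRing R] {ι n k : Type*} [Fintype ι] [DecidableEq ι]
    (A : n → k → ℤ) (f : ι → n) (c : ι → k) :
    ((((Matrix.of A).submatrix f c).det : ℤ) : R) =
      ((Matrix.of fun i j => (A i j : R)).submatrix f c).det := by
  rw [Int.cast_det]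
  rfl

lemma RowsIndep.exists_minor {p : ℕ} (hp : p.Prime) {n k : ℕ} {A : Fin n → Fin k → ℤ}
    (h : RowsIndep p A) :
    ∃ c : Fin n ↪o Fin k, ¬ (p : ℤ) ∣ ((Matrix.of A).submatrix id c).det := by
  have := Fact.mk hp
  obtain ⟨c, hc⟩ := Matrix.exists_minor_ne_zero_of_linearIndependent
    (A := Matrix.of fun i j => (A i j : ZMod p)) h
  refine ⟨c, ?_⟩
  rwa [← ZMod.intCast_zmod_eq_zero_iff_dvd, intCast_minor]

lemma rowsIndep_of_minor {p : ℕ} (hp : p.Prime) {n k : ℕ} {A : Fin n → Fin k → ℤ}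
    (c : Fin n → Fin k) (h : ¬ (p : ℤ) ∣ ((Matrix.of A).submatrix id c).det) :
    RowsIndep p A := by
  have := Fact.mk hp
  rw [← ZMod.intCast_zmod_eq_zero_iff_dvd, intCast_minor] at h
  exact Matrix.linearIndependent_row_of_minor_ne_zero c h

lemma greatestDivisor_eq_one_iff {n k : ℕ} (A : Fin n → Fin k → ℤ) :
    greatestDivisor (Matrix.of A) = 1 ↔ ∀ p : ℕ, p.Prime → RowsIndep p A := by
  constructor
  · intro h p hp
    by_contra hA
    have hdvd : (p : ℤ) ∣ greatestDivisor (Matrix.of A) :=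
      Finset.dvd_gcd fun c _ => by
        by_contra hc
        exact hA (rowsIndep_of_minor hp c hc)
    rw [h] at hdvd
    exact hp.one_lt.ne' (by exact_mod_cast Int.eq_one_of_dvd_one (by positivity) hdvd)
  · intro h
    by_contra hg
    have hnorm : normalize (greatestDivisor (Matrix.of A)) = greatestDivisor (Matrix.of A) :=
      Finset.normalize_gcd
    have hnn : 0 ≤ greatestDivisor (Matrix.of A) := Int.nonneg_of_normalize_eq_self hnorm
    -- Nonnegativity excludes the value `-1`; the value `0` needs no separate case, since every
    -- prime divides it.
    obtain ⟨p, hp, hpd⟩ := Nat.exists_prime_and_dvd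
      (n := (greatestDivisor (Matrix.of A)).natAbs) (by omega)
    obtain ⟨c, hc⟩ := (h p hp).exists_minor hp
    exact hc ((Int.natCast_dvd.2 hpd).trans (Finset.gcd_dvd (Finset.mem_univ c)))

/-- The integers `d` for which `A * X = d • 1` is solvable form an ideal. By the adjugate identity
it contains every maximal minor, hence their gcd. -/
lemma exists_right_inverse_of_greatestDivisor_eq_one {n k : ℕ} {A : Matrix (Fin n) (Fin k) ℤ}
    (h : greatestDivisor A = 1) : ∃ X : Matrix (Fin k) (Fin n) ℤ, A * X = 1 := by
  let I : Ideal ℤ :=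
    { carrier := {d | ∃ X : Matrix (Fin k) (Fin n) ℤ, A * X = d • (1 : Matrix (Fin n) (Fin n) ℤ)}
      add_mem' := by
        rintro a b ⟨X, hX⟩ ⟨Y, hY⟩
        exact ⟨X + Y, by rw [Matrix.mul_add, hX, hY, add_smul]⟩
      zero_mem' := ⟨0, by simp⟩
      smul_mem' := by
        rintro a b ⟨X, hX⟩
        exact ⟨a • X, by rw [Matrix.mul_smul, hX, smul_smul, smul_eq_mul]⟩ }
  have hI : ∀ c : Fin n ↪o Fin k, (A.submatrix id c).det ∈ I := by
    intro c
    refine ⟨(1 : Matrix (Fin k) (Fin k) ℤ).submatrix id c * (A.submatrix id c).adjugate, ?_⟩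
    rw [← Matrix.mul_assoc]
    have : A * (1 : Matrix (Fin k) (Fin k) ℤ).submatrix id c = A.submatrix id c := by
      ext i j
      simp [Matrix.mul_apply, Matrix.one_apply]
    rw [this, Matrix.mul_adjugate]
  obtain ⟨g, hg⟩ := (IsPrincipalIdealRing.principal I).principal
  have hg1 : g ∣ 1 := by
    rw [← h]
    refine Finset.dvd_gcd fun c _ => ?_
    have := hI c
    rw [hg] at this
    exact Ideal.mem_span_singleton.1 this
  have h1 : (1 : ℤ) ∈ I := by
    rw [hg]
    exact Ideal.mem_span_singleton.2 hg1
  obtain ⟨X, hX⟩ := h1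
  exact ⟨X, by simpa using hX⟩

lemma mem_satSystems_of_greatestDivisor_eq_one {G : Type*} [AddCommGroup G] {n k : ℕ}
    (s : EquationSystem G k n) (h : greatestDivisor (Matrix.of fun i => (s i).1) = 1) :
    s ∈ satSystems G k n := by
  obtain ⟨X, hX⟩ := exists_right_inverse_of_greatestDivisor_eq_one h
  refine ⟨fun j => ∑ l, X j l • (s l).2, fun i => ?_⟩
  unfold GroupEquation.IsSolution
  have hX' : ∀ l, ∑ j, (s i).1 j * X j l = if i = l then 1 else 0 := fun l => by
    have := congrFun (congrFun hX i) l
    rwa [Matrix.mul_apply, Matrix.one_apply] at this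
  simp_rw [Finset.smul_sum, smul_smul]
  rw [Finset.sum_comm]
  simp_rw [← Finset.sum_smul, hX']
  simp

/-- Take the shortest dependent initial segment; it is non-empty because the empty family is
independent. -/
lemma exists_first_dependent {K V : Type*} [Ring K] [AddCommGroup V] [Module K V] {n : ℕ}
    (f : Fin n → V) (h : ¬ LinearIndependent K f) :
    ∃ i : Fin n, LinearIndependent K (fun j : Fin i => f (j.castLE i.2.le)) ∧
      ¬ LinearIndependent K (fun j : Fin (i + 1) => f (j.castLE i.2)) := by
  have hex : ∃ t, ∃ ht : t ≤ n, ¬ LinearIndependent K (fun j : Fin t => f (j.castLE ht)) :=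
    ⟨n, le_rfl, h⟩
  classical
  obtain ⟨ht, hdep⟩ := Nat.find_spec hex
  obtain ⟨i, hi⟩ : ∃ i, Nat.find hex = i + 1 := by
    refine Nat.exists_eq_succ_of_ne_zero fun h0 => hdep ?_
    have : IsEmpty (Fin (Nat.find hex)) := by rw [h0]; infer_instance
    exact linearIndependent_empty_type
  have hin : i + 1 ≤ n := hi ▸ ht
  refine ⟨⟨i, hin⟩, ?_, ?_⟩
  · have := Nat.find_min hex (m := i) (by omega)
    push Not at this
    exact this _
  · intro hli
    apply hdep
    have : ∀ t (h1 : t = i + 1) (h2 : t ≤ n),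
        LinearIndependent K (fun j : Fin t => f (j.castLE h2)) := by
      rintro t rfl h2
      exact hli
    exact this _ hi ht

end Minors

/-! ### Equidistribution in residue classes -/

section Residues

open Stratification

/-- The count in an interval of `2r+1` integers is a difference of two floors, hence within `1` of
`(2r+1)/M`. -/
lemma abs_proportion_residue_sub_le (M : ℕ) [NeZero M] (a : ZMod M) (r : ℕ) :
    |(balls ℤ).proportion {x : ℤ | (x : ZMod M) = a} r - 1 / M| ≤ 1 / (2 * r + 1) := by
  have hM : 0 < (M : ℤ) := by exact_mod_cast Nat.pos_of_ne_zero (NeZero.ne M)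
  obtain ⟨v, rfl⟩ := ZMod.intCast_surjective a
  have hset : {x : ℤ | (x : ZMod M) = v} ∩ (balls ℤ).stratum r =
      ((Finset.Ioc (-(r : ℤ) - 1) r).filter fun x => x ≡ v [ZMOD M] : Finset ℤ) := by
    ext x
    simp [balls_int, ← ZMod.intCast_eq_intCast_iff, and_comm]
  have hcard := Int.Ioc_filter_modEq_card (-(r : ℤ) - 1) r hM v
  unfold proportion
  rw [hset, Set.ncard_coe_finset, ncard_balls_int]
  set N := ((Finset.Ioc (-(r : ℤ) - 1) r).filter fun x => x ≡ v [ZMOD M]).card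
  have hMR : (0 : ℝ) < M := by exact_mod_cast hM
  have hMQ : (0 : ℚ) < M := by exact_mod_cast hM
  have key : |(N : ℚ) - (2 * r + 1) / M| ≤ 1 := by
    have h1 := Int.floor_le (((r : ℤ) - v : ℚ) / M)
    have h2 := Int.lt_floor_add_one (((r : ℤ) - v : ℚ) / M)
    have h3 := Int.floor_le (((-(r : ℤ) - 1 : ℤ) - v : ℚ) / M)
    have h4 := Int.lt_floor_add_one (((-(r : ℤ) - 1 : ℤ) - v : ℚ) / M)
    have h5 : ((r : ℤ) - v : ℚ) / M - ((-(r : ℤ) - 1 : ℤ) - v : ℚ) / M = (2 * r + 1) / M := by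
      push_cast; ring
    have h6 : ⌊((-(r : ℤ) - 1 : ℤ) - v : ℚ) / M⌋ ≤ ⌊((r : ℤ) - v : ℚ) / M⌋ := by
      apply Int.floor_le_floor
      rw [← sub_nonneg, h5]
      positivity
    rw [Int.cast_natCast M, max_eq_left (by linarith)] at hcard
    have hq : (N : ℚ) = (⌊((r : ℤ) - v : ℚ) / M⌋ : ℚ) - ⌊((-(r : ℤ) - 1 : ℤ) - v : ℚ) / M⌋ := by
      exact_mod_cast hcard
    rw [abs_le, hq]
    constructor <;> linarith
  have key' : |(N : ℝ) - (2 * r + 1) / M| ≤ 1 := by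
    have := (Rat.cast_le (K := ℝ)).2 key
    push_cast at this
    exact this
  have hr : (0 : ℝ) < 2 * r + 1 := by positivity
  have : (N : ℝ) / ((2 * r + 1 : ℕ) : ℝ) - 1 / M = (N - (2 * r + 1) / M) / (2 * r + 1) := by
    push_cast
    field_simp
  rw [this, abs_div, abs_of_pos hr]
  gcongr

lemma tendsto_one_div_two_mul_add_one :
    Tendsto (fun r : ℕ => (1 : ℝ) / (2 * r + 1)) atTop (𝓝 0) := by
  refine squeeze_zero (fun r => by positivity) (fun r => ?_)
    tendsto_one_div_add_atTop_nhds_zero_nat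
  have : (0 : ℝ) ≤ r := r.cast_nonneg
  gcongr
  linarith

lemma tendsto_proportion_residue (M : ℕ) [NeZero M] (a : ZMod M) :
    Tendsto ((balls ℤ).proportion {x : ℤ | (x : ZMod M) = a}) atTop (𝓝 (1 / M)) := by
  rw [tendsto_iff_norm_sub_tendsto_zero]
  exact squeeze_zero (fun _ => norm_nonneg _) (abs_proportion_residue_sub_le M a)
    tendsto_one_div_two_mul_add_one

/-- A bound uniform in `r` as long as the modulus does not exceed the number of points; this is what
makes the medium primes summable. -/
lemma proportion_residue_le (M : ℕ) [NeZero M] (a : ZMod M) {r : ℕ} (h : M ≤ 2 * r + 1) :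
    (balls ℤ).proportion {x : ℤ | (x : ZMod M) = a} r ≤ 2 / M := by
  have h1 := (abs_le.1 (abs_proportion_residue_sub_le M a r)).2
  have hM : (0 : ℝ) < M := by exact_mod_cast Nat.pos_of_ne_zero (NeZero.ne M)
  have h2 : (1 : ℝ) / (2 * r + 1) ≤ 1 / M := by
    gcongr
    exact_mod_cast h
  have h3 : (2 : ℝ) / M = 1 / M + 1 / M := by ring
  linarith

lemma tendsto_proportion_residues {ι : Type*} [Fintype ι] (q : ι → ℕ) [∀ i, NeZero (q i)]
    (hq : Pairwise (Function.onFun Nat.Coprime q)) (a : ∀ i, ZMod (q i)) :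
    Tendsto ((balls ℤ).proportion {x : ℤ | ∀ i, (x : ZMod (q i)) = a i}) atTop
      (𝓝 (∏ i, 1 / (q i : ℝ))) := by
  have : NeZero (∏ i, q i) := ⟨Finset.prod_ne_zero_iff.2 fun i _ => NeZero.ne (q i)⟩
  have h := tendsto_proportion_residue (∏ i, q i) ((ZMod.prodEquivPi q hq).symm a)
  have hset : {x : ℤ | ∀ i, (x : ZMod (q i)) = a i} =
      {x : ℤ | (x : ZMod (∏ i, q i)) = (ZMod.prodEquivPi q hq).symm a} := by
    ext x
    simp only [Set.mem_ofPred_eq]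
    rw [← (ZMod.prodEquivPi q hq).injective.eq_iff, RingEquiv.apply_symm_apply, map_intCast,
      funext_iff]
    rfl
  rw [hset]
  convert h using 2
  push_cast
  rw [Finset.prod_div_distrib]
  simp

/-- The reduction of an integer matrix modulo `p`. -/
def reduceMod (p : ℕ) {n k : ℕ} (A : Fin n → Fin k → ℤ) : Fin n → Fin k → ZMod p :=
  fun i j => A i j

/-- The density of a set of integer matrices defined by conditions modulo pairwise coprime
numbers is the product of the local densities. -/
lemma hasDensity_reduceMod {ι : Type*} [Fintype ι] (q : ι → ℕ) [∀ i, NeZero (q i)]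
    (hq : Pairwise (Function.onFun Nat.Coprime q)) {n k : ℕ}
    (S : ∀ i, Finset (Fin n → Fin k → ZMod (q i))) :
    (balls (Fin n → Fin k → ℤ)).HasDensity {A | ∀ i, reduceMod (q i) A ∈ S i}
      (∏ i, ((S i).card : ℝ) / (q i : ℝ) ^ (n * k)) := by
  classical
  have hset : {A : Fin n → Fin k → ℤ | ∀ i, reduceMod (q i) A ∈ S i} =
      (fun A i => reduceMod (q i) A) ⁻¹' (Fintype.piFinset S) := by
    ext A; simp
  have hfib : ∀ a : ∀ i, Fin n → Fin k → ZMod (q i),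
      ((fun (A : Fin n → Fin k → ℤ) i => reduceMod (q i) A) ⁻¹' {a}) =
      {A | ∀ b, A b ∈ {v : Fin k → ℤ | ∀ c, v c ∈ {x : ℤ | ∀ i, (x : ZMod (q i)) = a i b c}}} := by
    intro a
    ext A
    simp only [Set.mem_preimage, Set.mem_singleton_iff, funext_iff, Set.mem_ofPred_eq, reduceMod]
    exact ⟨fun h b c i => h i b c, fun h i b c => h b c i⟩
  have hlim : Tendsto (fun r => ∑ a ∈ Fintype.piFinset S, ∏ b, ∏ c,
      (balls ℤ).proportion {x : ℤ | ∀ i, (x : ZMod (q i)) = a i b c} r) atTop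
      (𝓝 (∑ a ∈ Fintype.piFinset S, ∏ b : Fin n, ∏ c : Fin k, ∏ i, 1 / (q i : ℝ))) :=
    tendsto_finsetSum _ fun a _ => tendsto_finsetProd _ fun b _ => tendsto_finsetProd _ fun c _ =>
      tendsto_proportion_residues q hq _
  unfold HasDensity
  convert hlim using 1
  · ext r
    rw [hset, proportion_preimage]
    refine Finset.sum_congr rfl fun a _ => ?_
    rw [hfib, proportion_pi]
    refine Finset.prod_congr rfl fun b _ => ?_
    rw [proportion_pi]
  · simp only [Finset.prod_const, Finset.card_univ, Fintype.card_fin, Finset.sum_const,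
      Fintype.card_piFinset, nsmul_eq_mul, Nat.cast_prod]
    rw [Finset.prod_div_distrib, Finset.prod_div_distrib, ← pow_mul, Finset.prod_pow]
    simp only [Finset.prod_const_one, mul_comm k n]
    rw [one_div, inv_pow, div_eq_mul_inv]

lemma proportion_reduceMod_le (p : ℕ) [NeZero p] {n k : ℕ}
    (S : Finset (Fin n → Fin k → ZMod p)) {r : ℕ} (h : p ≤ 2 * r + 1) :
    (balls (Fin n → Fin k → ℤ)).proportion {A | reduceMod p A ∈ S} r ≤
      2 ^ (n * k) * (S.card / (p : ℝ) ^ (n * k)) := by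
  classical
  have hfib : ∀ a : Fin n → Fin k → ZMod p,
      ((fun (A : Fin n → Fin k → ℤ) => reduceMod p A) ⁻¹' {a}) =
      {A | ∀ b, A b ∈ {v : Fin k → ℤ | ∀ c, v c ∈ {x : ℤ | (x : ZMod p) = a b c}}} := by
    intro a
    ext A
    simp only [Set.mem_preimage, Set.mem_singleton_iff, funext_iff, Set.mem_ofPred_eq, reduceMod]
  change (balls (Fin n → Fin k → ℤ)).proportion (reduceMod p ⁻¹' S) r ≤ _
  rw [proportion_preimage]
  calc _ ≤ ∑ a ∈ S, ∏ b : Fin n, ∏ c : Fin k, (2 / p : ℝ) := by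
        refine Finset.sum_le_sum fun a _ => ?_
        rw [hfib, proportion_pi]
        refine Finset.prod_le_prod (fun b _ => proportion_nonneg _ _ _) fun b _ => ?_
        rw [proportion_pi]
        exact Finset.prod_le_prod (fun b _ => proportion_nonneg _ _ _) fun c _ =>
          proportion_residue_le p _ h
    _ = _ := by
        simp only [Finset.prod_const, Finset.card_univ, Fintype.card_fin, Finset.sum_const,
          nsmul_eq_mul]
        rw [← pow_mul, div_pow, mul_comm k n]
        ring

end Residues

/-! ### Primes larger than the box -/

section LargePrimes

open Stratification

/-- The product of these primes divides `D`. More than `K + e` of them would force `R ^ K ≤ K`. The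
bound is crude, but does not depend on `R`. -/
lemma card_large_prime_divisors_le {D : ℕ} (hD : D ≠ 0) {K e R : ℕ} (hR : 2 ≤ R)
    (h : D ≤ K * R ^ e) : (D.primeFactors.filter (R < ·)).card ≤ K + e := by
  by_contra! hlt
  set S := D.primeFactors.filter (R < ·)
  have h1 : R ^ S.card ≤ D := by
    calc R ^ S.card = ∏ _p ∈ S, R := by simp
      _ ≤ ∏ p ∈ S, p := Finset.prod_le_prod' fun p hp => (Finset.mem_filter.1 hp).2.le
      _ ≤ D := Nat.le_of_dvd (Nat.pos_of_ne_zero hD)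
        ((Finset.prod_dvd_prod_of_subset _ _ _ (Finset.filter_subset _ _)).trans
          (Nat.prod_primeFactors_dvd D))
  have h2 : R ^ (K + e) ≤ K * R ^ e := (Nat.pow_le_pow_right (by omega) hlt.le).trans (h1.trans h)
  rw [pow_add] at h2
  have h3 : R ^ K ≤ K := Nat.le_of_mul_le_mul_right h2 (by positivity)
  exact absurd h3 (not_le.2 (Nat.lt_pow_self (by omega)))

lemma proportion_int_le_of_subsingleton {M : Set ℤ} {r : ℕ}
    (h : ∀ x ∈ M, ∀ y ∈ M, |x| ≤ (r : ℤ) → |y| ≤ (r : ℤ) → x = y) :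
    (balls ℤ).proportion M r ≤ 1 / (2 * r + 1) := by
  unfold proportion
  rw [ncard_balls_int]
  have : (M ∩ (balls ℤ).stratum r).ncard ≤ 1 := by
    rw [Set.ncard_le_one (((balls ℤ).finite r).inter_of_right M)]
    exact fun x hx y hy => h x hx.1 y hy.1 (mem_balls_int.1 hx.2) (mem_balls_int.1 hy.2)
  push_cast
  gcongr
  exact_mod_cast this

/-- A prime larger than the diameter of the box pins down a solution of a linear congruence. -/
lemma proportion_linear_congruence_le {p : ℕ} (hp : p.Prime) {r : ℕ} (hr : 2 * r + 1 < p)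
    {μ : ℤ} (hμ : ¬ (p : ℤ) ∣ μ) (a : ℤ) :
    (balls ℤ).proportion {s | (p : ℤ) ∣ a + s * μ} r ≤ 1 / (2 * r + 1) := by
  refine proportion_int_le_of_subsingleton fun x hx y hy hxr hyr => ?_
  have h1 : (p : ℤ) ∣ (x - y) * μ := by
    have := dvd_sub hx hy
    rwa [show a + x * μ - (a + y * μ) = (x - y) * μ by ring] at this
  have h2 := ((Nat.prime_iff_prime_int.1 hp).dvd_or_dvd h1).resolve_right hμ
  have h3 : |x - y| < p := by
    rw [abs_le] at hxr hyr
    rw [abs_lt]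
    constructor <;> omega
  exact sub_eq_zero.1 (Int.eq_zero_of_abs_lt_dvd h2 h3)

/-- The minor of `A` extended by the row `t`, in the columns `c` and `e`. -/
def borderedMinor {n k : ℕ} (A : Fin n → Fin k → ℤ) (c : Fin n → Fin k) (e : Fin k)
    (t : Fin k → ℤ) : ℤ :=
  ((Matrix.of (Fin.snoc A t : Fin (n + 1) → Fin k → ℤ)).submatrix id
    (Fin.snoc c e : Fin (n + 1) → Fin k)).det

/-- Laplace expansion along the last row: the cofactors `α` do not involve `t`, and `t e` is
multiplied by the unbordered minor. So the bordered minor is linear in `t` and reads only the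
entries in the columns `c` and `e`. -/
lemma borderedMinor_expand {n k : ℕ} (A : Fin n → Fin k → ℤ) (c : Fin n → Fin k) (e : Fin k) :
    ∃ α : Fin n → ℤ, ∀ t : Fin k → ℤ, borderedMinor A c e t =
      ∑ j, α j * t (c j) + t e * ((Matrix.of A).submatrix id c).det := by
  refine ⟨fun j => (-1) ^ (n + j : ℕ) * (Matrix.of fun (i l : Fin n) =>
    A i ((Fin.snoc c e : Fin (n + 1) → Fin k) (j.castSucc.succAbove l))).det, fun t => ?_⟩
  unfold borderedMinor
  rw [Matrix.det_succ_row _ (Fin.last n), Fin.sum_univ_castSucc]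
  congr 1
  · refine Finset.sum_congr rfl fun j _ => ?_
    have : (((Matrix.of (Fin.snoc A t : Fin (n + 1) → Fin k → ℤ)).submatrix id
        (Fin.snoc c e : Fin (n + 1) → Fin k)).submatrix (Fin.last n).succAbove
          j.castSucc.succAbove) = Matrix.of fun (i l : Fin n) =>
        A i ((Fin.snoc c e : Fin (n + 1) → Fin k) (j.castSucc.succAbove l)) := by
      ext i l
      simp
    rw [this]
    simp
    ring
  · have : (((Matrix.of (Fin.snoc A t : Fin (n + 1) → Fin k → ℤ)).submatrix id
        (Fin.snoc c e : Fin (n + 1) → Fin k)).submatrix (Fin.last n).succAbove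
          (Fin.last n).succAbove) = (Matrix.of A).submatrix id c := by
      ext i l
      simp
    rw [this]
    simp [← two_mul]

lemma abs_borderedMinor_le {n k : ℕ} {A : Fin n → Fin k → ℤ} (c : Fin n → Fin k) (e : Fin k)
    {t : Fin k → ℤ} {r : ℕ} (hA : ∀ i j, |A i j| ≤ (r : ℤ)) (ht : ∀ j, |t j| ≤ (r : ℤ)) :
    (borderedMinor A c e t).natAbs ≤ (n + 1).factorial * (2 * r + 1) ^ (n + 1) := by
  have h := Matrix.det_le (abv := AbsoluteValue.abs (S := ℤ)) (x := (r : ℤ))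
    (A := (Matrix.of (Fin.snoc A t : Fin (n + 1) → Fin k → ℤ)).submatrix id
      (Fin.snoc c e : Fin (n + 1) → Fin k)) (fun i j => by
      simp only [AbsoluteValue.abs_apply, Matrix.submatrix_apply, id, Matrix.of_apply]
      induction i using Fin.lastCases with
      | last => simpa using ht _
      | cast i => simpa using hA _ _)
  simp only [Fintype.card_fin, AbsoluteValue.abs_apply, nsmul_eq_mul] at h
  change |borderedMinor A c e t| ≤ _ at h
  zify
  -- The base `r` is enlarged to `2r+1` to match the threshold above which primes are counted.
  refine h.trans ?_
  gcongr
  omega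

lemma dvd_borderedMinor {p : ℕ} (hp : p.Prime) {n k : ℕ} {A : Fin n → Fin k → ℤ}
    {t : Fin k → ℤ} (h : ¬ RowsIndep p (Fin.snoc A t : Fin (n + 1) → Fin k → ℤ))
    (c : Fin n → Fin k) (e : Fin k) : (p : ℤ) ∣ borderedMinor A c e t := by
  by_contra hc
  exact h (rowsIndep_of_minor hp (Fin.snoc c e : Fin (n + 1) → Fin k) hc)

/-- Along the coordinate `e` the bordered minor is affine with nonzero slope, so it has at most one
zero. -/
lemma proportion_borderedMinor_eq_zero_le {n k : ℕ} (A : Fin n → Fin k → ℤ) {c : Fin n → Fin k}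
    {e : Fin k} (he : ∀ j, c j ≠ e) (r : ℕ) :
    (balls (Fin k → ℤ)).proportion {t | ((Matrix.of A).submatrix id c).det ≠ 0 ∧
      borderedMinor A c e t = 0} r ≤ 1 / (2 * r + 1) := by
  obtain ⟨α, hα⟩ := borderedMinor_expand A c e
  refine proportion_le_of_update e _ r _ fun v _ => ?_
  refine proportion_int_le_of_subsingleton fun x hx y hy _ _ => ?_
  obtain ⟨hμ, hx⟩ := hx
  obtain ⟨-, hy⟩ := hy
  rw [hα] at hx hy
  simp only [Function.update_self, Function.update_of_ne (he _)] at hx hy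
  exact mul_right_cancel₀ hμ (by linarith)

/-- Only the coordinate `d` varies. The minor bordered by `e` stays fixed, which leaves a bounded
list of candidate primes; for each, the minor bordered by `d` is affine in that coordinate with
slope invertible modulo `p`, so at most one value in the box survives. -/
lemma proportion_common_prime_le {n k : ℕ} (A : Fin n → Fin k → ℤ) {c : Fin n → Fin k}
    {e d : Fin k} (hd : ∀ j, c j ≠ d) (hed : e ≠ d) {r : ℕ} (hr : 1 ≤ r) :
    (balls (Fin k → ℤ)).proportion {t | borderedMinor A c e t ≠ 0 ∧
      (borderedMinor A c e t).natAbs ≤ (n + 1).factorial * (2 * r + 1) ^ (n + 1) ∧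
      ∃ p : ℕ, p.Prime ∧ 2 * r + 1 < p ∧ ¬ (p : ℤ) ∣ ((Matrix.of A).submatrix id c).det ∧
        (p : ℤ) ∣ borderedMinor A c e t ∧ (p : ℤ) ∣ borderedMinor A c d t} r ≤
      ((n + 1).factorial + (n + 1) : ℕ) * (1 / (2 * r + 1)) := by
  obtain ⟨α, hα⟩ := borderedMinor_expand A c e
  obtain ⟨β, hβ⟩ := borderedMinor_expand A c d
  refine proportion_le_of_update d _ r _ fun v _ => ?_
  have hconst : ∀ s, borderedMinor A c e (Function.update v d s) = borderedMinor A c e v := by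
    intro s
    rw [hα, hα]
    simp only [Function.update_of_ne (hd _), Function.update_of_ne hed]
  have hlin : ∀ s, borderedMinor A c d (Function.update v d s) =
      ∑ j, β j * v (c j) + s * ((Matrix.of A).submatrix id c).det := by
    intro s
    rw [hβ]
    simp only [Function.update_of_ne (hd _), Function.update_self]
  simp only [Set.mem_ofPred_eq, hconst, hlin]
  by_cases hD : borderedMinor A c e v ≠ 0 ∧
      (borderedMinor A c e v).natAbs ≤ (n + 1).factorial * (2 * r + 1) ^ (n + 1)
  · obtain ⟨hD0, hDle⟩ := hD
    have hcard := card_large_prime_divisors_le (Int.natAbs_ne_zero.2 hD0) (by omega) hDle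
    set S := (borderedMinor A c e v).natAbs.primeFactors.filter (2 * r + 1 < ·) with hS
    set μ := ((Matrix.of A).submatrix id c).det
    set S' := S.filter fun p : ℕ => ¬ (p : ℤ) ∣ μ
    calc _ ≤ (balls ℤ).proportion (⋃ p ∈ S', {s | (p : ℤ) ∣ ∑ j, β j * v (c j) + s * μ}) r := by
          refine proportion_mono _ ?_ r
          rintro s ⟨-, -, p, hp, hpr, hpμ, hpe, hpd⟩
          simp only [Set.mem_iUnion]
          refine ⟨p, ?_, hpd⟩
          simp only [S', S, Finset.mem_filter, Nat.mem_primeFactors]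
          exact ⟨⟨⟨hp, Int.natCast_dvd.1 hpe, Int.natAbs_ne_zero.2 hD0⟩, hpr⟩, hpμ⟩
      _ ≤ ∑ p ∈ S', (balls ℤ).proportion {s | (p : ℤ) ∣ ∑ j, β j * v (c j) + s * μ} r :=
          proportion_biUnion_le _ _ _ _
      _ ≤ ∑ p ∈ S', (1 / (2 * r + 1) : ℝ) := by
          refine Finset.sum_le_sum fun p hp => ?_
          simp only [S', S, Finset.mem_filter, Nat.mem_primeFactors] at hp
          exact proportion_linear_congruence_le hp.1.1.1 hp.1.2 hp.2 _
      _ ≤ _ := by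
          rw [Finset.sum_const, nsmul_eq_mul]
          gcongr
          exact (Finset.card_filter_le _ _).trans hcard
  · rw [show {s : ℤ | borderedMinor A c e v ≠ 0 ∧ (borderedMinor A c e v).natAbs ≤
        (n + 1).factorial * (2 * r + 1) ^ (n + 1) ∧ ∃ p : ℕ, p.Prime ∧ 2 * r + 1 < p ∧
        ¬ (p : ℤ) ∣ ((Matrix.of A).submatrix id c).det ∧ (p : ℤ) ∣ borderedMinor A c e v ∧
        (p : ℤ) ∣ ∑ j, β j * v (c j) + s * ((Matrix.of A).submatrix id c).det} = ∅ from
      Set.eq_empty_of_forall_notMem fun s hs => hD ⟨hs.1, hs.2.1⟩, proportion_empty]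
    positivity

lemma proportion_dependent_row_le {n k : ℕ} (hnk : n + 2 ≤ k) {r : ℕ} (hr : 1 ≤ r)
    {A : Fin n → Fin k → ℤ} (hA : ∀ i j, |A i j| ≤ (r : ℤ)) :
    (balls (Fin k → ℤ)).proportion {t | ∃ p : ℕ, p.Prime ∧ 2 * r + 1 < p ∧ RowsIndep p A ∧
      ¬ RowsIndep p (Fin.snoc A t : Fin (n + 1) → Fin k → ℤ)} r ≤
      (Fintype.card (Fin n ↪o Fin k) * (1 + ((n + 1).factorial + (n + 1)) : ℕ)) *
        (1 / (2 * r + 1)) := by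
  classical
  -- The hypothesis `n + 2 ≤ k` leaves two columns outside any minor.
  have hcols : ∀ c : Fin n ↪o Fin k, ∃ e d : Fin k, e ≠ d ∧ (∀ j, c j ≠ e) ∧ ∀ j, c j ≠ d := by
    intro c
    have h1 : 1 < (Finset.univ.image c)ᶜ.card := by
      rw [Finset.card_compl, Finset.card_image_of_injective _ c.injective]
      simp
      omega
    obtain ⟨e, he, d, hd, hed⟩ := Finset.one_lt_card.1 h1
    simp only [Finset.mem_compl, Finset.mem_image, Finset.mem_univ, true_and, not_exists] at he hd
    exact ⟨e, d, hed, he, hd⟩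
  choose e d hed he hd using hcols
  let N₁ : (Fin n ↪o Fin k) → Set (Fin k → ℤ) := fun c =>
    {t | ((Matrix.of A).submatrix id c).det ≠ 0 ∧ borderedMinor A c (e c) t = 0}
  let N₂ : (Fin n ↪o Fin k) → Set (Fin k → ℤ) := fun c =>
    {t | borderedMinor A c (e c) t ≠ 0 ∧
      (borderedMinor A c (e c) t).natAbs ≤ (n + 1).factorial * (2 * r + 1) ^ (n + 1) ∧
      ∃ p : ℕ, p.Prime ∧ 2 * r + 1 < p ∧ ¬ (p : ℤ) ∣ ((Matrix.of A).submatrix id c).det ∧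
        (p : ℤ) ∣ borderedMinor A c (e c) t ∧ (p : ℤ) ∣ borderedMinor A c (d c) t}
  calc _ ≤ (balls (Fin k → ℤ)).proportion (⋃ c ∈ Finset.univ, (N₁ c ∪ N₂ c)) r := by
        refine proportion_mono_on _ ?_
        rintro t ht ⟨p, hp, hpr, hind, hdep⟩
        obtain ⟨c, hc⟩ := hind.exists_minor hp
        have ht' : ∀ j, |t j| ≤ (r : ℤ) := fun j => mem_balls_int.1 (mem_balls_pi.1 ht j)
        simp only [Set.mem_iUnion]
        refine ⟨c, Finset.mem_univ c, ?_⟩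
        by_cases h0 : borderedMinor A c (e c) t = 0
        · exact Or.inl ⟨fun h => hc (h ▸ dvd_zero _), h0⟩
        · exact Or.inr ⟨h0, abs_borderedMinor_le c _ hA ht', p, hp, hpr, hc,
            dvd_borderedMinor hp hdep c _, dvd_borderedMinor hp hdep c _⟩
    _ ≤ ∑ c : Fin n ↪o Fin k, (balls (Fin k → ℤ)).proportion (N₁ c ∪ N₂ c) r :=
        proportion_biUnion_le _ _ _ _
    _ ≤ ∑ c : Fin n ↪o Fin k, ((1 + ((n + 1).factorial + (n + 1)) : ℕ) : ℝ) *
          (1 / (2 * r + 1)) := by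
        refine Finset.sum_le_sum fun c _ => (proportion_union_le _ _ _ _).trans ?_
        rw [Nat.cast_add, Nat.cast_one, add_mul, one_mul]
        exact add_le_add (proportion_borderedMinor_eq_zero_le A (he c) r)
          (proportion_common_prime_le A (hd c) (hed c) hr)
    _ = _ := by
        rw [Finset.sum_const, nsmul_eq_mul, Finset.card_univ]
        push_cast
        ring

/-- The integer matrices that have dependent rows modulo some prime exceeding the diameter of the
box are negligible. -/
lemma exists_proportion_large_prime_le {n k : ℕ} (hnk : n < k) :
    ∃ C : ℝ, ∀ r : ℕ, 1 ≤ r → (balls (Fin n → Fin k → ℤ)).proportion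
      {A | ∃ p : ℕ, p.Prime ∧ 2 * r + 1 < p ∧ ¬ RowsIndep p A} r ≤ C * (1 / (2 * r + 1)) := by
  classical
  refine ⟨∑ i : Fin n, (Fintype.card (Fin i ↪o Fin k) *
    (1 + ((i + 1 : ℕ).factorial + (i + 1)) : ℕ) : ℝ), fun r hr => ?_⟩
  let M : Fin n → Set (Fin n → Fin k → ℤ) := fun i =>
    {A | ∃ p : ℕ, p.Prime ∧ 2 * r + 1 < p ∧ RowsIndep p (fun j : Fin i => A (j.castLE i.2.le)) ∧
      ¬ RowsIndep p (fun j : Fin (i + 1) => A (j.castLE i.2))}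
  calc _ ≤ (balls (Fin n → Fin k → ℤ)).proportion (⋃ i ∈ Finset.univ, M i) r := by
        refine proportion_mono _ ?_ r
        rintro A ⟨p, hp, hpr, hA⟩
        obtain ⟨i, h1, h2⟩ := exists_first_dependent _ hA
        simp only [Set.mem_iUnion]
        exact ⟨i, Finset.mem_univ i, p, hp, hpr, h1, h2⟩
    _ ≤ ∑ i, (balls (Fin n → Fin k → ℤ)).proportion (M i) r := proportion_biUnion_le _ _ _ _
    _ ≤ _ := by
        rw [Finset.sum_mul]
        refine Finset.sum_le_sum fun i _ => ?_
        -- All rows but the `i`-th are frozen; the later ones do not enter the condition. As `i < n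
        -- < k`, there is room for two extra columns.
        refine proportion_le_of_update i _ r _ fun v hv => ?_
        have hv' : ∀ i j, |v i j| ≤ (r : ℤ) := fun i j =>
          mem_balls_int.1 (mem_balls_pi.1 (mem_balls_pi.1 hv i) j)
        refine le_trans (le_of_eq ?_) (proportion_dependent_row_le (n := i) (k := k)
          (by omega) hr (A := fun j => v (j.castLE i.2.le)) fun _ _ => hv' _ _)
        congr 1
        ext t
        have e1 : (fun j : Fin i => Function.update v i t (j.castLE i.2.le)) =
            fun j : Fin i => v (j.castLE i.2.le) := by
          funext j
          exact Function.update_of_ne (Fin.ne_of_lt j.2) _ _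
        have e2 : (fun j : Fin (i + 1) => Function.update v i t (j.castLE i.2)) =
            (Fin.snoc (fun j : Fin i => v (j.castLE i.2.le)) t : Fin (i + 1) → Fin k → ℤ) := by
          funext j
          induction j using Fin.lastCases with
          | last =>
            rw [Fin.snoc_last]
            exact Function.update_self i t v
          | cast j =>
            rw [Fin.snoc_castSucc]
            exact Function.update_of_ne (Fin.ne_of_lt j.2) _ _
        simp only [M, Set.mem_ofPred_eq, e1, e2]

end LargePrimes

/-! ### The sieve and the density of unimodular matrices -/

section UnimodularDensity

open Stratification

lemma one_sub_sum_le_prod_one_sub {ι : Type*} (s : Finset ι) (x : ι → ℝ) (h0 : ∀ i ∈ s, 0 ≤ x i)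
    (h1 : ∀ i ∈ s, x i ≤ 1) : 1 - ∑ i ∈ s, x i ≤ ∏ i ∈ s, (1 - x i) := by
  classical
  induction s using Finset.induction_on with
  | empty => simp
  | insert a s ha ih =>
    rw [Finset.sum_insert ha, Finset.prod_insert ha]
    have ih' := ih (fun i hi => h0 i (Finset.mem_insert_of_mem hi))
      fun i hi => h1 i (Finset.mem_insert_of_mem hi)
    have ha0 := h0 a (Finset.mem_insert_self a s)
    have ha1 := h1 a (Finset.mem_insert_self a s)
    have hs : 0 ≤ ∑ i ∈ s, x i :=
      Finset.sum_nonneg fun i hi => h0 i (Finset.mem_insert_of_mem hi)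
    nlinarith [mul_le_mul_of_nonneg_left ih' (sub_nonneg.2 ha1), mul_nonneg ha0 hs]

/-- The proportion of the `n × k` matrices over the field with `p` elements that have independent
rows. -/
noncomputable def localDensity (n k p : ℕ) : ℝ :=
  ∏ j ∈ Finset.Icc (k - n + 1) k, (1 - ((p : ℝ) ^ j)⁻¹)

open Classical in
/-- The matrices over `ZMod p` with independent rows. -/
noncomputable def indepMatrices (n k p : ℕ) [NeZero p] : Finset (Fin n → Fin k → ZMod p) :=
  Finset.univ.filter fun a => LinearIndependent (ZMod p) a

lemma reduceMod_mem_indepMatrices {n k p : ℕ} [NeZero p] (A : Fin n → Fin k → ℤ) :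
    reduceMod p A ∈ indepMatrices n k p ↔ RowsIndep p A := by
  simp only [indepMatrices, Finset.mem_filter, Finset.mem_univ, true_and]
  rfl

/-- Row `i` must avoid the `p ^ i` vectors in the span of the earlier rows. Dividing each factor `p
^ k - p ^ i` by `p ^ k` and putting `j = k - i` gives the product. -/
lemma card_indepMatrices_div {n k p : ℕ} (hp : p.Prime) [NeZero p] (hnk : n ≤ k) :
    ((indepMatrices n k p).card : ℝ) / (p : ℝ) ^ (n * k) = localDensity n k p := by
  classical
  have := Fact.mk hp
  have h := card_linearIndependent (K := ZMod p) (V := Fin k → ZMod p) (k := n) (by simpa using hnk)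
  rw [Nat.card_eq_fintype_card, Fintype.card_subtype] at h
  have hcard : (indepMatrices n k p).card = ∏ i : Fin n, (p ^ k - p ^ i.val) := by
    rw [indepMatrices]
    simpa using h
  have hp0 : (p : ℝ) ≠ 0 := by exact_mod_cast hp.ne_zero
  rw [hcard, Nat.cast_prod, mul_comm n k, pow_mul]
  have : ∏ i : Fin n, ((p ^ k - p ^ i.val : ℕ) : ℝ) =
      (∏ i : Fin n, (1 - ((p : ℝ) ^ (k - i.val))⁻¹)) * ((p : ℝ) ^ k) ^ n := by
    rw [show ((p : ℝ) ^ k) ^ n = ∏ _i : Fin n, (p : ℝ) ^ k by simp, ← Finset.prod_mul_distrib]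
    refine Finset.prod_congr rfl fun i _ => ?_
    have hik : i.val ≤ k := i.2.le.trans hnk
    rw [Nat.cast_sub (Nat.pow_le_pow_right hp.pos hik)]
    push_cast
    rw [sub_mul, one_mul, pow_sub₀ _ hp0 hik]
    congr 1
    field_simp
  rw [this, mul_div_cancel_right₀ _ (by positivity), localDensity,
    Fin.prod_univ_eq_prod_range (fun i => 1 - ((p : ℝ) ^ (k - i))⁻¹) n]
  refine Finset.prod_bij' (fun i _ => k - i) (fun j _ => k - j) ?_ ?_ ?_ ?_ ?_ <;>
    simp only [Finset.mem_range, Finset.mem_Icc] <;> intros <;> first | omega | trivial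

/-- Since `n < k`, all exponents are at least `2`, so the local loss is summable over primes. -/
lemma localDensity_ge {n k p : ℕ} (hp : p.Prime) (hnk : n < k) :
    1 - n * ((p : ℝ) ^ 2)⁻¹ ≤ localDensity n k p := by
  have hp1 : (1 : ℝ) ≤ p := by exact_mod_cast hp.one_lt.le
  refine le_trans ?_ (one_sub_sum_le_prod_one_sub _ _ (fun i _ => by positivity)
    fun i _ => inv_le_one_of_one_le₀ (one_le_pow₀ hp1))
  have : ∑ j ∈ Finset.Icc (k - n + 1) k, ((p : ℝ) ^ j)⁻¹ ≤
      ∑ j ∈ Finset.Icc (k - n + 1) k, ((p : ℝ) ^ 2)⁻¹ := by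
    refine Finset.sum_le_sum fun j hj => ?_
    have := (Finset.mem_Icc.1 hj).1
    have h2j : 2 ≤ j := by omega
    gcongr
  rw [Finset.sum_const, Nat.card_Icc, show k + 1 - (k - n + 1) = n by omega, nsmul_eq_mul] at this
  linarith

lemma proportion_not_rowsIndep_le {n k p : ℕ} (hp : p.Prime) (hnk : n < k) {r : ℕ}
    (h : p ≤ 2 * r + 1) :
    (balls (Fin n → Fin k → ℤ)).proportion {A | ¬ RowsIndep p A} r ≤
      2 ^ (n * k) * (n * ((p : ℝ) ^ 2)⁻¹) := by
  classical
  have : NeZero p := ⟨hp.ne_zero⟩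
  have hp0 : (p : ℝ) ≠ 0 := by exact_mod_cast hp.ne_zero
  have h1 := proportion_reduceMod_le p (n := n) (k := k) (indepMatrices n k p)ᶜ h
  have hset : {A : Fin n → Fin k → ℤ | ¬ RowsIndep p A} =
      {A | reduceMod p A ∈ (indepMatrices n k p)ᶜ} := by
    ext A
    simp [reduceMod_mem_indepMatrices]
  rw [hset]
  refine h1.trans ?_
  gcongr
  have hc : ((indepMatrices n k p)ᶜ.card : ℝ) =
      (p : ℝ) ^ (n * k) - (indepMatrices n k p).card := by
    have hle := Finset.card_le_univ (indepMatrices n k p)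
    rw [Finset.card_compl, Nat.cast_sub hle]
    simp [← pow_mul, mul_comm]
  rw [hc, sub_div, div_self (by positivity), card_indepMatrices_div hp hnk.le]
  have := localDensity_ge hp hnk
  linarith

lemma hasDensity_rowsIndep_small (n k : ℕ) (hnk : n < k) (P : ℕ) :
    (balls (Fin n → Fin k → ℤ)).HasDensity {A | ∀ p ∈ (P + 1).primesBelow, RowsIndep p A}
      (∏ p ∈ (P + 1).primesBelow, localDensity n k p) := by
  have hprime : ∀ p : (P + 1).primesBelow, (p : ℕ).Prime := fun p =>
    Nat.prime_of_mem_primesBelow p.2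
  have : ∀ p : (P + 1).primesBelow, NeZero (p : ℕ) := fun p => ⟨(hprime p).ne_zero⟩
  have h := hasDensity_reduceMod (fun p : (P + 1).primesBelow => (p : ℕ))
    (fun p q hpq => (Nat.coprime_primes (hprime p) (hprime q)).2 fun h => hpq (Subtype.ext h))
    (n := n) (k := k) (fun p => indepMatrices n k p)
  convert h using 1
  · ext A
    simp [reduceMod_mem_indepMatrices]
  · rw [← Finset.prod_coe_sort]
    exact Finset.prod_congr rfl fun p _ => (card_indepMatrices_div (hprime p) hnk.le).symm

/-- A set that is squeezed, up to a uniformly small error, between sets with convergent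
proportions has a convergent proportion. -/
lemma tendsto_of_sieve {u : ℕ → ℝ} {G : ℕ → ℕ → ℝ} {g τ e : ℕ → ℝ} {δ : ℝ}
    (hG : ∀ P, Tendsto (G P) atTop (𝓝 (g P))) (hg : Tendsto g atTop (𝓝 δ))
    (hτ : Tendsto τ atTop (𝓝 0)) (he : Tendsto e atTop (𝓝 0))
    (h1 : ∀ P r, u r ≤ G P r) (h2 : ∀ P, ∀ᶠ r in atTop, G P r ≤ u r + τ P + e r) :
    Tendsto u atTop (𝓝 δ) := by
  rw [Metric.tendsto_nhds]
  intro ε hε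
  -- The four quarters of `ε` are spent on `g P` against `δ`, on `τ P`, on `G P r` against `g P`,
  -- and on `e r`.
  have hg' := Metric.tendsto_nhds.1 hg (ε / 4) (by positivity)
  have hτ' := Metric.tendsto_nhds.1 hτ (ε / 4) (by positivity)
  obtain ⟨P, hP1, hP2⟩ := (hg'.and hτ').exists
  filter_upwards [Metric.tendsto_nhds.1 (hG P) (ε / 4) (by positivity),
    Metric.tendsto_nhds.1 he (ε / 4) (by positivity), h2 P] with r hr1 hr2 hr3
  have := h1 P r
  rw [Real.dist_eq, abs_lt] at *
  constructor <;> linarith [hP1.1, hP1.2, hP2.1, hP2.2, hr1.1, hr1.2, hr2.1, hr2.2]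

lemma hasDensity_unimodular_of_tendsto {n k : ℕ} (hnk : n < k) {δ : ℝ}
    (h : Tendsto (fun N : ℕ => ∏ p ∈ N.primesBelow, localDensity n k p) atTop (𝓝 δ)) :
    (balls (Fin n → Fin k → ℤ)).HasDensity (unimodularMatrices n k) δ := by
  obtain ⟨C, hC⟩ := exists_proportion_large_prime_le hnk
  -- The factor `2 / (P + 1)` bounds the tail of `∑ 1/p²` beyond `P`.
  have hτ : Tendsto (fun P : ℕ => (2 : ℝ) ^ (n * k) * n * (2 * (1 / ((P : ℝ) + 1)))) atTop
      (𝓝 0) := by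
    simpa using (tendsto_one_div_add_atTop_nhds_zero_nat (𝕜 := ℝ)).const_mul 2 |>.const_mul
      ((2 : ℝ) ^ (n * k) * n)
  have he : Tendsto (fun r : ℕ => C * (1 / (2 * (r : ℝ) + 1))) atTop (𝓝 0) := by
    simpa using tendsto_one_div_two_mul_add_one.const_mul C
  refine tendsto_of_sieve (fun P => hasDensity_rowsIndep_small n k hnk P)
    ((tendsto_add_atTop_iff_nat 1).2 h) hτ he (fun P r => ?_) fun P => ?_
  · refine proportion_mono _ (fun A hA p hp => ?_) r
    exact (greatestDivisor_eq_one_iff A).1 hA p (Nat.prime_of_mem_primesBelow hp)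
  · filter_upwards [eventually_ge_atTop 1] with r hr
    -- The medium primes, `P < p ≤ 2r + 1`.
    let S := (Finset.Ioo P (2 * r + 2)).filter Nat.Prime
    let L : Set (Fin n → Fin k → ℤ) := {A | ∃ p : ℕ, p.Prime ∧ 2 * r + 1 < p ∧ ¬ RowsIndep p A}
    calc _ ≤ (balls (Fin n → Fin k → ℤ)).proportion
          (unimodularMatrices n k ∪ (⋃ p ∈ S, {A | ¬ RowsIndep p A}) ∪ L) r := by
          refine proportion_mono _ (fun A hA => ?_) r
          by_cases hU : A ∈ unimodularMatrices n k
          · exact Or.inl (Or.inl hU)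
          have hU' := (greatestDivisor_eq_one_iff A).not.1 hU
          push Not at hU'
          obtain ⟨p, hp, hpA⟩ := hU'
          by_cases hpr : 2 * r + 1 < p
          · exact Or.inr ⟨p, hp, hpr, hpA⟩
          · refine Or.inl (Or.inr ?_)
            simp only [Set.mem_iUnion]
            refine ⟨p, ?_, hpA⟩
            simp only [S, Finset.mem_filter, Finset.mem_Ioo]
            refine ⟨⟨?_, by omega⟩, hp⟩
            by_contra hpP
            exact hpA (hA p (Nat.mem_primesBelow.2 ⟨by omega, hp⟩))
      _ ≤ (balls (Fin n → Fin k → ℤ)).proportion (unimodularMatrices n k) r +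
          ∑ p ∈ S, (balls (Fin n → Fin k → ℤ)).proportion {A | ¬ RowsIndep p A} r +
          (balls (Fin n → Fin k → ℤ)).proportion L r := by
          refine (proportion_union_le _ _ _ _).trans (add_le_add_left ?_ _)
          refine (proportion_union_le _ _ _ _).trans (add_le_add_right ?_ _)
          exact proportion_biUnion_le _ _ _ _
      _ ≤ _ := by
          refine add_le_add (add_le_add_right ?_ _) (hC r hr)
          calc _ ≤ ∑ p ∈ S, (2 : ℝ) ^ (n * k) * (n * ((p : ℝ) ^ 2)⁻¹) := by
                refine Finset.sum_le_sum fun p hp => ?_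
                simp only [S, Finset.mem_filter, Finset.mem_Ioo] at hp
                exact proportion_not_rowsIndep_le hp.2 hnk (by omega)
            _ ≤ ∑ p ∈ Finset.Ioo P (2 * r + 2), (2 : ℝ) ^ (n * k) * (n * ((p : ℝ) ^ 2)⁻¹) :=
                Finset.sum_le_sum_of_subset_of_nonneg (Finset.filter_subset _ _)
                  fun p _ _ => by positivity
            _ = (2 : ℝ) ^ (n * k) * n * ∑ p ∈ Finset.Ioo P (2 * r + 2), ((p : ℝ) ^ 2)⁻¹ := by
                rw [Finset.mul_sum]
                exact Finset.sum_congr rfl fun p _ => by ring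
            _ ≤ _ := by
                gcongr
                rw [mul_one_div]
                exact sum_Ioo_inv_sq_le P (2 * r + 2)

/-- Densities are real and `riemannZeta` is complex valued, so limits are stated with real series;
the term at `0` vanishes by the convention `1 / 0 = 0`. -/
lemma riemannZeta_natCast_eq_ofReal {j : ℕ} (hj : 1 < j) :
    riemannZeta (j : ℂ) = ((∑' n : ℕ, 1 / (n : ℝ) ^ j : ℝ) : ℂ) := by
  rw [zeta_nat_eq_tsum_of_gt_one hj, Complex.ofReal_tsum]
  push_cast
  rfl

lemma tendsto_prod_localDensity {n k : ℕ} (hnk : n < k) :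
    Tendsto (fun N : ℕ => ∏ p ∈ N.primesBelow, localDensity n k p) atTop
      (𝓝 (∏ j ∈ Finset.Icc (k - n + 1) k, ∑' i : ℕ, 1 / (i : ℝ) ^ j)⁻¹) := by
  rw [← Filter.tendsto_ofReal_iff]
  have h : ∀ j ∈ Finset.Icc (k - n + 1) k, Tendsto (fun N : ℕ => ∏ p ∈ N.primesBelow,
      (1 - ((p : ℂ) ^ j)⁻¹)) atTop (𝓝 (((∑' i : ℕ, 1 / (i : ℝ) ^ j : ℝ) : ℂ)⁻¹)) := by
    intro j hj
    have hj1 : 1 < j := by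
      have := (Finset.mem_Icc.1 hj).1
      omega
    have hre : 1 < (j : ℂ).re := by simpa using hj1
    have hz := (riemannZeta_eulerProduct hre).inv₀ (riemannZeta_ne_zero_of_one_le_re hre.le)
    rw [riemannZeta_natCast_eq_ofReal hj1] at hz
    refine hz.congr fun N => ?_
    rw [← Finset.prod_inv_distrib]
    refine Finset.prod_congr rfl fun p _ => ?_
    rw [inv_inv, Complex.cpow_neg, Complex.cpow_natCast]
  have h' := tendsto_finsetProd _ h
  rw [Finset.prod_inv_distrib] at h'
  simp only [localDensity]
  push_cast at h' ⊢
  refine h'.congr fun N => ?_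
  rw [Finset.prod_comm]

/-- The density of the unimodular matrices. -/
theorem hasDensity_unimodularMatrices {n k : ℕ} (hnk : n < k) :
    (balls (Fin n → Fin k → ℤ)).HasDensity (unimodularMatrices n k)
      (∏ j ∈ Finset.Icc (k - n + 1) k, ∑' i : ℕ, 1 / (i : ℝ) ^ j)⁻¹ :=
  hasDensity_unimodular_of_tendsto hnk (tendsto_prod_localDensity hnk)

end UnimodularDensity

/-! ### The density of solvable single equations -/

section EquationDensity

open Stratification

/-- The primitive integer vectors. -/
def primitiveVectors (k : ℕ) : Set (Fin k → ℤ) := {γ | Finset.univ.gcd γ = 1}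

lemma greatestDivisor_one_row {k : ℕ} (A : Fin 1 → Fin k → ℤ) :
    greatestDivisor (Matrix.of A) = Finset.univ.gcd (A 0) := by
  refine dvd_antisymm_of_normalize_eq Finset.normalize_gcd Finset.normalize_gcd ?_ ?_
  · refine Finset.dvd_gcd fun j _ => ?_
    have h := Finset.gcd_dvd (f := fun c : Fin 1 ↪o Fin k => ((Matrix.of A).submatrix id c).det)
      (Finset.mem_univ (OrderEmbedding.ofMapLEIff (fun _ : Fin 1 => j) (by simp)))
    rw [Matrix.det_fin_one] at h
    exact h
  · refine Finset.dvd_gcd fun c _ => ?_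
    rw [Matrix.det_fin_one]
    exact Finset.gcd_dvd (Finset.mem_univ (c 0))

lemma hasDensity_primitiveVectors {k : ℕ} (hk : 1 < k) :
    (balls (Fin k → ℤ)).HasDensity (primitiveVectors k) (∑' i : ℕ, 1 / (i : ℝ) ^ k)⁻¹ := by
  have h := hasDensity_unimodularMatrices hk
  rw [Nat.sub_add_cancel hk.le, Finset.Icc_self, Finset.prod_singleton] at h
  have hset : unimodularMatrices 1 k =
      {A : Fin 1 → Fin k → ℤ | ∀ i, A i ∈ primitiveVectors k} := by
    ext A
    simp [unimodularMatrices, greatestDivisor_one_row, primitiveVectors]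
  refine h.congr fun r => ?_
  rw [hset, proportion_pi]
  simp

lemma exists_sum_mul_eq_gcd {k : ℕ} (γ : Fin k → ℤ) :
    ∃ u : Fin k → ℤ, ∑ j, u j * γ j = Finset.univ.gcd γ := by
  obtain ⟨g, hg⟩ := (IsPrincipalIdealRing.principal (Ideal.span (Set.range γ))).principal
  have hdvd : g ∣ Finset.univ.gcd γ := by
    refine Finset.dvd_gcd fun j _ => ?_
    have : γ j ∈ Ideal.span (Set.range γ) := Ideal.subset_span ⟨j, rfl⟩
    rw [hg] at this
    exact Ideal.mem_span_singleton.1 this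
  have hmem : Finset.univ.gcd γ ∈ Ideal.span (Set.range γ) := by
    rw [hg]
    exact Ideal.mem_span_singleton.2 hdvd
  obtain ⟨u, hu⟩ := (Submodule.mem_span_range_iff_exists_fun ℤ).1 hmem
  exact ⟨u, by simpa using hu⟩

/-- Bézout in each coordinate of `ℤ ^ m`. A zero gcd is covered too: it divides only `0`. -/
lemma mem_satEquations_iff {k m : ℕ} (e : GroupEquation (Fin m → ℤ) k) :
    e ∈ satEquations (Fin m → ℤ) k ↔ ∀ i, Finset.univ.gcd e.1 ∣ e.2 i := by
  constructor
  · rintro ⟨x, hx⟩ i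
    rw [← (show _ = e.2 from hx), Finset.sum_apply]
    exact Finset.dvd_sum fun j _ => (Finset.gcd_dvd (Finset.mem_univ j)).mul_right _
  · intro h
    choose q hq using h
    obtain ⟨u, hu⟩ := exists_sum_mul_eq_gcd e.1
    refine ⟨fun j i => u j * q i, ?_⟩
    change _ = e.2
    ext i
    rw [Finset.sum_apply, hq, ← hu, Finset.sum_mul]
    exact Finset.sum_congr rfl fun j _ => by simp; ring

lemma ncard_balls_equation (k m r : ℕ) :
    ((balls (GroupEquation (Fin m → ℤ) k)).stratum r).ncard = (2 * r + 1) ^ (k + m) := by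
  rw [balls_prod, Set.ncard_prod, ncard_balls_pi, ncard_balls_pi, ncard_balls_int]
  simp [pow_add]

/-- The solvable equations whose coefficients have greatest common divisor `d`. -/
def satEquationsOfGcd (k m d : ℕ) : Set (GroupEquation (Fin m → ℤ) k) :=
  {e | Finset.univ.gcd e.1 = d ∧ ∀ i, (d : ℤ) ∣ e.2 i}

lemma mem_balls_equation {k m r : ℕ} {e : GroupEquation (Fin m → ℤ) k} :
    e ∈ (balls (GroupEquation (Fin m → ℤ) k)).stratum r ↔
      (∀ j, |e.1 j| ≤ (r : ℤ)) ∧ ∀ i, |e.2 i| ≤ (r : ℤ) := by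
  rw [balls_prod, Set.mem_prod, mem_balls_pi, mem_balls_pi]
  simp only [mem_balls_int]

/-- Divide the equation by `d`: the coefficients become primitive, the right-hand side arbitrary,
and `|d x| ≤ r` means `|x| ≤ ⌊r / d⌋`. -/
lemma satEquationsOfGcd_inter_balls (k m : ℕ) {d : ℕ} (hd : 0 < d) (r : ℕ) :
    satEquationsOfGcd k m d ∩ (balls (GroupEquation (Fin m → ℤ) k)).stratum r =
      (fun e => (d : ℤ) • e) '' ((primitiveVectors k ×ˢ Set.univ) ∩
        (balls (GroupEquation (Fin m → ℤ) k)).stratum (r / d)) := by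
  have hd0 : (d : ℤ) ≠ 0 := by exact_mod_cast hd.ne'
  have habs : ∀ x : ℤ, |(d : ℤ) * x| ≤ r ↔ |x| ≤ ((r / d : ℕ) : ℤ) := by
    intro x
    rw [abs_mul, Nat.abs_cast, Int.natCast_div, Int.le_ediv_iff_mul_le (by exact_mod_cast hd),
      mul_comm]
  have hgcd : ∀ γ : Fin k → ℤ, (Finset.univ.gcd fun j => (d : ℤ) * γ j) =
      d * Finset.univ.gcd γ := by
    intro γ
    rw [Finset.gcd_mul_left, Int.normalize_of_nonneg (Int.natCast_nonneg d)]
  ext ⟨γ, b⟩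
  simp only [Set.mem_inter_iff, Set.mem_image, mem_balls_equation, satEquationsOfGcd,
    Set.mem_prod, Set.mem_univ, and_true, primitiveVectors, Set.mem_ofPred_eq]
  constructor
  · rintro ⟨⟨hg, hb⟩, h1, h2⟩
    choose b' hb' using hb
    have hγ : ∀ j, (d : ℤ) ∣ γ j := fun j => hg ▸ Finset.gcd_dvd (Finset.mem_univ j)
    choose γ' hγ' using hγ
    obtain rfl : γ = fun j => (d : ℤ) * γ' j := funext hγ'
    obtain rfl : b = fun j => (d : ℤ) * b' j := funext hb'
    simp only [habs] at h1 h2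
    rw [hgcd] at hg
    refine ⟨(γ', b'), ⟨?_, h1, h2⟩, rfl⟩
    exact mul_left_cancel₀ hd0 (by rw [hg, mul_one])
  · rintro ⟨⟨γ', b'⟩, ⟨hg, h1, h2⟩, heq⟩
    obtain ⟨rfl, rfl⟩ := Prod.mk.inj heq
    refine ⟨⟨?_, fun i => ⟨b' i, rfl⟩⟩, fun j => (habs _).2 (h1 j), fun i => (habs _).2 (h2 i)⟩
    change (Finset.univ.gcd fun j => (d : ℤ) * γ' j) = d
    rw [hgcd]
    simp only at hg
    rw [hg, mul_one]

/-- The contribution to the proportion of the solvable equations of those with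
greatest common divisor `d`. -/
noncomputable def gcdTerm (k m r d : ℕ) : ℝ :=
  (balls (Fin k → ℤ)).proportion (primitiveVectors k) (r / d) *
    ((2 * (r / d : ℕ) + 1) / (2 * r + 1)) ^ (k + m)

lemma proportion_satEquationsOfGcd (k m : ℕ) {d : ℕ} (hd : 0 < d) (r : ℕ) :
    (balls (GroupEquation (Fin m → ℤ) k)).proportion (satEquationsOfGcd k m d) r =
      gcdTerm k m r d := by
  have hinj : Function.Injective (fun e : GroupEquation (Fin m → ℤ) k => (d : ℤ) • e) :=
    smul_right_injective _ (by exact_mod_cast hd.ne')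
  have h := proportion_prod (primitiveVectors k) (Set.univ : Set (Fin m → ℤ)) (r / d)
  rw [proportion_univ, mul_one] at h
  unfold gcdTerm
  rw [← h]
  unfold proportion
  rw [satEquationsOfGcd_inter_balls k m hd, Set.ncard_image_of_injective _ hinj,
    ncard_balls_equation, ncard_balls_equation, div_pow]
  push_cast
  have : (0 : ℝ) < (2 * ((r / d : ℕ) : ℝ) + 1) ^ (k + m) := by positivity
  field_simp

/-- A ball of radius `0` contains only the zero vector, which is not primitive. This covers `d > r`
and also `d = 0`, where `r / 0 = 0`, so the sum may run over all naturals. -/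
lemma gcdTerm_eq_zero {k m r d : ℕ} (h : r / d = 0) : gcdTerm k m r d = 0 := by
  unfold gcdTerm
  have : primitiveVectors k ∩ (balls (Fin k → ℤ)).stratum 0 = ∅ := by
    refine Set.eq_empty_of_forall_notMem fun γ hγ => ?_
    have h0 : γ = 0 := by simpa [mem_balls] using hγ.2
    have h1 : Finset.univ.gcd γ = 1 := hγ.1
    rw [Finset.gcd_eq_zero_iff.2 (by simp [h0])] at h1
    exact zero_ne_one h1
  rw [h, proportion, this]
  simp

/-- Partition by the gcd of the coefficients. Gcd `0` leaves only the zero equation, giving the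
first summand; a nonzero gcd divides some nonzero coefficient and so is at most `r`. -/
lemma proportion_satEquations (k m r : ℕ) :
    (balls (GroupEquation (Fin m → ℤ) k)).proportion (satEquations (Fin m → ℤ) k) r =
      1 / (2 * (r : ℝ) + 1) ^ (k + m) + ∑' d, gcdTerm k m r d := by
  have hsum : ∑' d, gcdTerm k m r d = ∑ d ∈ Finset.Icc 1 r, gcdTerm k m r d := by
    refine tsum_eq_sum fun d hd => gcdTerm_eq_zero ?_
    rw [Finset.mem_Icc, not_and_or] at hd
    rcases Nat.eq_zero_or_pos d with rfl | h
    · simp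
    · exact Nat.div_eq_of_lt (by omega)
  have hzero : (balls (GroupEquation (Fin m → ℤ) k)).proportion {0} r =
      1 / (2 * (r : ℝ) + 1) ^ (k + m) := by
    unfold proportion
    rw [Set.inter_eq_left.2 (by simp [mem_balls]), Set.ncard_singleton, ncard_balls_equation]
    push_cast
    rfl
  have hdisj : ((Finset.Icc 1 r : Finset ℕ) : Set ℕ).PairwiseDisjoint (satEquationsOfGcd k m) := by
    intro a _ b _ hab
    refine Set.disjoint_left.2 fun e ha hb => hab ?_
    exact_mod_cast ha.1.symm.trans hb.1
  have hdisj0 : Disjoint {0} (⋃ d ∈ Finset.Icc 1 r, satEquationsOfGcd k m d) := by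
    rw [Set.disjoint_singleton_left]
    simp only [Set.mem_iUnion, not_exists]
    rintro d hd ⟨h, -⟩
    rw [Finset.gcd_eq_zero_iff.2 (by simp)] at h
    have := (Finset.mem_Icc.1 hd).1
    omega
  have hkey : ∀ e ∈ (balls (GroupEquation (Fin m → ℤ) k)).stratum r,
      e ∈ satEquations (Fin m → ℤ) k ↔
        e ∈ {0} ∪ ⋃ d ∈ Finset.Icc 1 r, satEquationsOfGcd k m d := by
    intro e he
    rw [mem_satEquations_iff]
    simp only [Set.mem_union, Set.mem_singleton_iff, Set.mem_iUnion]
    have hnn : 0 ≤ Finset.univ.gcd e.1 := Int.nonneg_of_normalize_eq_self Finset.normalize_gcd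
    obtain ⟨g, hg⟩ := Int.eq_ofNat_of_zero_le hnn
    constructor
    · intro h
      rcases Nat.eq_zero_or_pos g with rfl | hpos
      · left
        have hg0 := Finset.gcd_eq_zero_iff.1 hg
        refine Prod.ext (funext fun j => hg0 j (Finset.mem_univ j)) (funext fun i => ?_)
        have := h i
        rw [hg] at this
        exact zero_dvd_iff.1 this
      · right
        refine ⟨g, ?_, hg, fun i => hg ▸ h i⟩
        rw [Finset.mem_Icc]
        refine ⟨hpos, ?_⟩
        have hne : Finset.univ.gcd e.1 ≠ 0 := by rw [hg]; exact_mod_cast hpos.ne'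
        rw [Ne, Finset.gcd_eq_zero_iff] at hne
        push Not at hne
        obtain ⟨j, -, hj⟩ := hne
        have h1 : (g : ℤ) ∣ e.1 j := hg ▸ Finset.gcd_dvd (Finset.mem_univ j)
        have h2 := Int.le_of_dvd (abs_pos.2 hj) ((dvd_abs _ _).2 h1)
        exact_mod_cast h2.trans ((mem_balls_equation.1 he).1 j)
    · rintro (rfl | ⟨d, -, hd, h⟩)
      · simp
      · exact fun i => hd ▸ h i
  rw [hsum, ← hzero, ← Finset.sum_congr rfl fun d hd =>
      proportion_satEquationsOfGcd k m (Finset.mem_Icc.1 hd).1 r,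
    ← proportion_biUnion _ _ _ hdisj, ← proportion_union _ hdisj0]
  exact le_antisymm (proportion_mono_on _ fun e he h => (hkey e he).1 h)
    (proportion_mono_on _ fun e he h => (hkey e he).2 h)

/-- The error is `(d - 1 - 2 (r mod d)) / d` over `2r + 1`, and the remainder is at most `d - 1`. -/
lemma abs_ratio_sub_le {d : ℕ} (hd : 0 < d) (r : ℕ) :
    |(2 * ((r / d : ℕ) : ℝ) + 1) / (2 * r + 1) - 1 / d| ≤ 1 / (2 * r + 1) := by
  have hdR : (0 : ℝ) < d := by exact_mod_cast hd
  have hr : (0 : ℝ) < 2 * r + 1 := by positivity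
  have h1 : (d : ℝ) * (r / d : ℕ) + (r % d : ℕ) = r := by exact_mod_cast Nat.div_add_mod r d
  have h2 : ((r % d : ℕ) : ℝ) + 1 ≤ d := by exact_mod_cast Nat.mod_lt r hd
  have h3 : (0 : ℝ) ≤ (r % d : ℕ) := Nat.cast_nonneg _
  have : (2 * ((r / d : ℕ) : ℝ) + 1) / (2 * r + 1) - 1 / d =
      ((d - 1 - 2 * (r % d : ℕ)) / d) / (2 * r + 1) := by
    field_simp
    linarith
  rw [this, abs_div, abs_of_pos hr]
  gcongr
  rw [abs_div, abs_of_pos hdR, div_le_one hdR, abs_le]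
  constructor <;> linarith

lemma tendsto_gcdTerm {k m d : ℕ} (hk : 1 < k) :
    Tendsto (fun r => gcdTerm k m r d) atTop
      (𝓝 ((∑' i : ℕ, 1 / (i : ℝ) ^ k)⁻¹ * (1 / (d : ℝ) ^ (k + m)))) := by
  rcases Nat.eq_zero_or_pos d with rfl | hd
  · have h0 : k + m ≠ 0 := by omega
    simp only [gcdTerm_eq_zero (Nat.div_zero _), Nat.cast_zero, zero_pow h0, div_zero, mul_zero]
    exact tendsto_const_nhds
  have h1 : Tendsto (fun r : ℕ => r / d) atTop atTop := Nat.tendsto_div_const_atTop hd.ne'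
  have h2 : Tendsto (fun r : ℕ => (2 * ((r / d : ℕ) : ℝ) + 1) / (2 * r + 1)) atTop
      (𝓝 (1 / d)) := by
    rw [tendsto_iff_norm_sub_tendsto_zero]
    exact squeeze_zero (fun _ => norm_nonneg _) (abs_ratio_sub_le hd)
      tendsto_one_div_two_mul_add_one
  have h3 := ((hasDensity_primitiveVectors hk).comp h1).mul (h2.pow (k + m))
  rw [one_div_pow] at h3
  exact h3

lemma gcdTerm_nonneg (k m r d : ℕ) : 0 ≤ gcdTerm k m r d :=
  mul_nonneg (proportion_nonneg _ _ _) (by positivity)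

/-- The summable majorant that permits passing to the limit under the sum over `d`. -/
lemma gcdTerm_le (k m r d : ℕ) : gcdTerm k m r d ≤ 2 ^ (k + m) * (1 / (d : ℝ) ^ (k + m)) := by
  by_cases h : r / d = 0
  · rw [gcdTerm_eq_zero h]
    positivity
  · have hd : 0 < d := Nat.pos_of_ne_zero fun h0 => h (by simp [h0])
    have hdr : d ≤ r := by
      by_contra hlt
      exact h (Nat.div_eq_of_lt (not_le.1 hlt))
    have hdR : (0 : ℝ) < d := by exact_mod_cast hd
    have hdrR : (d : ℝ) ≤ r := by exact_mod_cast hdr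
    have h1 : (d : ℝ) * (r / d : ℕ) ≤ r := by exact_mod_cast Nat.mul_div_le r d
    have h2 : (2 * ((r / d : ℕ) : ℝ) + 1) / (2 * r + 1) ≤ 2 / d := by
      rw [div_le_div_iff₀ (by positivity) hdR]
      linarith
    unfold gcdTerm
    rw [mul_one_div, ← div_pow]
    calc _ ≤ 1 * (2 / (d : ℝ)) ^ (k + m) := by
          gcongr
          exact proportion_le_one _ _ _
      _ = _ := one_mul _

/-- The density of the set of solvable equations over `ℤ ^ m`. -/
theorem hasDensity_satEquations {k : ℕ} (m : ℕ) (hk : 1 < k) :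
    (balls (GroupEquation (Fin m → ℤ) k)).HasDensity (satEquations (Fin m → ℤ) k)
      ((∑' i : ℕ, 1 / (i : ℝ) ^ (k + m)) / ∑' i : ℕ, 1 / (i : ℝ) ^ k) := by
  have hsummable : Summable fun d : ℕ => (2 : ℝ) ^ (k + m) * (1 / (d : ℝ) ^ (k + m)) :=
    (Real.summable_one_div_nat_pow.2 (by omega)).mul_left _
  have h1 := tendsto_tsum_of_dominated_convergence (𝓕 := atTop) (f := fun r d => gcdTerm k m r d)
    hsummable (fun d => tendsto_gcdTerm (m := m) (d := d) hk)
    (Eventually.of_forall fun r d => by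
      rw [Real.norm_of_nonneg (gcdTerm_nonneg k m r d)]
      exact gcdTerm_le k m r d)
  have h2 : Tendsto (fun r : ℕ => 1 / (2 * (r : ℝ) + 1) ^ (k + m)) atTop (𝓝 0) := by
    have := tendsto_one_div_two_mul_add_one.pow (k + m)
    rw [zero_pow (by omega)] at this
    exact this.congr fun r => one_div_pow _ _
  have h3 := h2.add h1
  rw [zero_add, tsum_mul_left, mul_comm, ← div_eq_mul_inv] at h3
  exact h3.congr fun r => (proportion_satEquations k m r).symm

end EquationDensity

/-! ### From single equations and matrices to systems -/

section Systems

open Stratification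

lemma Stratification.proportion_preimage_equiv {T T' : Type*} (S : Stratification T)
    (S' : Stratification T') (e : T ≃ T') {r : ℕ}
    (h : ∀ x, e x ∈ S'.stratum r ↔ x ∈ S.stratum r) (M : Set T') :
    S.proportion (e ⁻¹' M) r = S'.proportion M r := by
  have hS : S.stratum r = e ⁻¹' S'.stratum r := by
    ext x
    exact (h x).symm
  have hcard : ∀ N : Set T', (e ⁻¹' N).ncard = N.ncard := fun N =>
    Set.ncard_preimage_of_injective_subset_range e.injective (by simp)
  unfold proportion
  rw [hS, ← Set.preimage_inter, hcard, hcard]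

/-- Separating coefficients from right-hand sides preserves the uniform norm, and unimodular
coefficients with free right-hand sides form a product set. -/
lemma proportion_unimodularMatrices_le (m k n r : ℕ) :
    (balls (Fin n → Fin k → ℤ)).proportion (unimodularMatrices n k) r ≤
      (balls (EquationSystem (Fin m → ℤ) k n)).proportion (satSystems (Fin m → ℤ) k n) r := by
  let e : EquationSystem (Fin m → ℤ) k n ≃ (Fin n → Fin k → ℤ) × (Fin n → Fin m → ℤ) :=
    Equiv.arrowProdEquivProdArrow _ _ _
  have h := proportion_prod (unimodularMatrices n k) (Set.univ : Set (Fin n → Fin m → ℤ)) r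
  rw [proportion_univ, mul_one] at h
  rw [← h, ← proportion_preimage_equiv (balls (EquationSystem (Fin m → ℤ) k n)) _ e]
  · exact proportion_mono _
      (fun s hs => mem_satSystems_of_greatestDivisor_eq_one s hs.1) r
  · intro s
    rw [balls_prod, Set.mem_prod, mem_balls_pi, mem_balls_pi, mem_balls_pi, ← forall_and]
    simp only [balls_prod, Set.mem_prod]
    rfl

lemma upperDensity_satSystems_le {m k n : ℕ} {d : ℝ}
    (h : (balls (GroupEquation (Fin m → ℤ) k)).HasDensity (satEquations (Fin m → ℤ) k) d) :
    (balls (EquationSystem (Fin m → ℤ) k n)).upperDensity (satSystems (Fin m → ℤ) k n) ≤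
      d ^ n := by
  have hpow : Tendsto (fun r => (balls (GroupEquation (Fin m → ℤ) k)).proportion
      (satEquations (Fin m → ℤ) k) r ^ n) atTop (𝓝 (d ^ n)) := h.pow n
  unfold upperDensity
  rw [← hpow.limsup_eq]
  refine limsup_le_limsup (Eventually.of_forall fun r => ?_)
    (isBoundedUnder_proportion_ge _ _).isCoboundedUnder_le hpow.isBoundedUnder_le
  -- Solvability of each equation separately is necessary, and the rows of a system vary
  -- independently in the ball.
  calc _ ≤ (balls (EquationSystem (Fin m → ℤ) k n)).proportion
        {s | ∀ i, s i ∈ satEquations (Fin m → ℤ) k} r :=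
        proportion_mono _ (fun s hs i => hs.imp fun x hx => hx i) r
    _ = _ := by
        rw [proportion_pi]
        simp

lemma le_lowerDensity_satSystems {m k n : ℕ} {d : ℝ}
    (h : (balls (Fin n → Fin k → ℤ)).HasDensity (unimodularMatrices n k) d) :
    d ≤ (balls (EquationSystem (Fin m → ℤ) k n)).lowerDensity (satSystems (Fin m → ℤ) k n) := by
  unfold lowerDensity
  rw [← Tendsto.liminf_eq h]
  exact liminf_le_liminf (Eventually.of_forall (proportion_unimodularMatrices_le m k n))
    h.isBoundedUnder_ge (isBoundedUnder_proportion_le _ _).isCoboundedUnder_ge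

end Systems

theorem theorem5p9 (m k n : ℕ) :
    (1 < n → n < k →
      ∃ d : ℝ,
        (Stratification.balls (Fin n → Fin k → ℤ)).HasDensity (unimodularMatrices n k) d ∧
        (d : ℂ) = (∏ j ∈ Finset.Icc (k - n + 1) k, riemannZeta (j : ℂ))⁻¹ ∧
        d ≤ (Stratification.balls (EquationSystem (Fin m → ℤ) k n)).lowerDensity
          (satSystems (Fin m → ℤ) k n)) ∧
    (1 < n → n ≤ k →
      ∃ d : ℝ,
        (Stratification.balls (GroupEquation (Fin m → ℤ) k)).HasDensity
          (satEquations (Fin m → ℤ) k) d ∧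
        (d : ℂ) = riemannZeta ((k + m : ℕ) : ℂ) / riemannZeta (k : ℂ) ∧
        (Stratification.balls (EquationSystem (Fin m → ℤ) k n)).upperDensity
          (satSystems (Fin m → ℤ) k n) ≤ d ^ n) := by
  refine ⟨fun _ hnk => ⟨_, hasDensity_unimodularMatrices hnk, ?_,
    le_lowerDensity_satSystems (hasDensity_unimodularMatrices hnk)⟩, fun hn hnk =>
    ⟨_, hasDensity_satEquations m (hn.trans_le hnk), ?_,
      upperDensity_satSystems_le (hasDensity_satEquations m (hn.trans_le hnk))⟩⟩
  · rw [Complex.ofReal_inv, Complex.ofReal_prod]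
    congr 1
    refine Finset.prod_congr rfl fun j hj => ?_
    have := (Finset.mem_Icc.1 hj).1
    exact (riemannZeta_natCast_eq_ofReal (by omega)).symm
  · rw [Complex.ofReal_div, riemannZeta_natCast_eq_ofReal (by omega),
      riemannZeta_natCast_eq_ofReal (by omega)]
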